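/- **Model.** Let $P,N_0>0$, $\alpha>2$, $\beta>1$. The primary (secondary) nodes form a Poisson point process of density $n$ (of density $m=n^\beta$, independent of the primary one) on the unit square, and are grouped uniformly at random into source–destination pairs (if the number of nodes is odd, one node is only a relay). A network of density $x$ divides the square into square cells of area $a=\frac{2\log x}{x}$, enlarged so that exactly $\lfloor 1/\sqrt a\rfloor$ cells fit along a side. Time is slotted. Under 9-TDMA the cells active in a slot are those of a single one of the nine classes of cells modulo 3 in both directions; an active cell makes at most one transmission, to a node of the same or of a side-adjacent cell at a distance $d$ of at most the diagonal of a cell. The power received at distance $r$ is $r^{-\alpha}$ times the transmitted power, and a transmission has rate $\log_2(1+\mathrm{SINR})$ with noise power $N_0$, all other simultaneous transmissions of both networks being interference. *Primary network (direct multihop routing):* each cell is active in one out of 9 slots; each pair uses a route of nodes from its source to its destination that passes first along the row of cells of the source to the column of the destination, and then along this column; the hops handled by a cell are served cyclically; a transmission over the distance $d$ uses power $Pd^\alpha\le P$. *Secondary network:* it uses its own cells and 9-TDMA; a transmission over the distance $d$ uses power $\delta_P P d^\alpha$; its transmitters and receivers avoid the preservation regions, i.e. the blocks of nine secondary cells centred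 at the cells that contain primary nodes. Apart from these rules its behaviour (routes, order of activation, repetitions) is arbitrary. The primary network *achieves* the per-node throughput $T$ if each hop of each primary pair sustains rate $T$, averaged over all slots, for every such behaviour of the secondary network; its sum throughput is then $T$ times the number of primary pairs. "W.h.p." means with probability tending to 1 as $n\to\infty$. **Theorem.** Put $$I=P\,2^{\alpha/2+3}\sum_{t=1}^{\infty}t(3t-2)^{-\alpha},\qquad K_p=\frac19\log_2\Big(1+\frac{P}{N_0+I}\Big),\qquad \delta_{P,\max}=\Big(\frac{1}{(1+\frac{P}{N_0})^{1-\delta_{\rm loss}}-1}-\frac{N_0}{P}\Big)\frac{P}{I},$$ $$T_{\rm alone}(n)=\frac{K_p}{4\sqrt2}\,\frac{1}{\sqrt{n\log n}},\qquad S_{\rm alone}(n)=\frac{K_p(1-\epsilon)}{8\sqrt2}\sqrt{\frac{n}{\log n}}.$$ The primary network can be operated by direct multihop routing, with routes and schedule depending only on the primary nodes (hence not on the secondary network, $\beta$, $\epsilon$, $\delta_{\rm loss}$ or $\delta_P$), such that for all $\beta>1$ and $\epsilon\in(0,1)$: 1. w.h.p. it achieves the per-node throughput $T_{\rm alone}(n)$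 and a sum throughput of at least $S_{\rm alone}(n)$ when the secondary network is silent; 2. for every $\delta_{\rm loss}\in(0,1)$ and every $\delta_P\in(0,\min\{\delta_{P,\max},1\})$, w.h.p. it achieves, in the presence of the secondary network, the per-node throughput $T_p(n)=(1-\delta_{\rm loss})T_{\rm alone}(n)$ and a sum throughput of at least $S_p(n)=(1-\delta_{\rm loss})S_{\rm alone}(n)$. -/

import Mathlib

open MeasureTheory Filter Topology

noncomputable section

namespace CognitiveNetwork

/-! ## Random node placement -/

/-- The Euclidean plane. -/
abbrev Plane : Type := EuclideanSpace ℝ (Fin 2)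

/-- The unit square `[0,1)²`. -/
def unitSquare : Set Plane := {x | ∀ i, x i ∈ Set.Ico (0 : ℝ) 1}

/-- The uniform distribution on the unit square. -/
def uniformSquare : Measure Plane := volume.restrict unitSquare

instance : IsProbabilityMeasure uniformSquare := by
  constructor
  have h : unitSquare =
      (WithLp.ofLp : Plane → Fin 2 → ℝ) ⁻¹' (Set.univ.pi fun _ => Set.Ico (0 : ℝ) 1) := by
    ext x
    simp [unitSquare, Set.mem_pi]
  have hm : MeasurableSet (Set.univ.pi fun _ : Fin 2 => Set.Ico (0 : ℝ) 1) :=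
    MeasurableSet.univ_pi fun _ => measurableSet_Ico
  rw [uniformSquare, Measure.restrict_apply_univ, h,
    (PiLp.volume_preserving_ofLp (Fin 2)).measure_preimage hm.nullMeasurableSet, Real.volume_pi_Ico]
  simp

/-- A realization of a network: the number of nodes and the sequence of their positions. Only the
nodes with an index smaller than the number of nodes are present. -/
abbrev Config : Type := ℕ × (ℕ → Plane)

/-- The law of a Poisson point process of density `lam` on the unit square: a Poisson number of
nodes (mean `lam`) at independent, uniformly distributed positions. Since the labels carry no
information on the positions, pairing the nodes `2 * j` and `2 * j + 1` is a uniformly random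
grouping into pairs. -/
def poissonNetwork (lam : ℝ) : Measure Config :=
  (ProbabilityTheory.poissonMeasure lam.toNNReal).prod (Measure.infinitePi fun _ => uniformSquare)

/-- The number of source-destination pairs. The source of the `j`-th pair is the node `2 * j`, its
destination is the node `2 * j + 1`; if the number of nodes is odd, the last one is only a relay. -/
def numPairs (ω : Config) : ℕ := ω.1 / 2

/-! ## Square cells and nine-slot time division -/

/-- The cell area `2 log x / x` belonging to the density `x`. -/
def cellArea (x : ℝ) : ℝ := 2 * Real.log x / x

/-- The number of cells along a side of the unit square, for cells of area `a`. -/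
def cellsPerSide (a : ℝ) : ℕ := ⌊1 / √a⌋₊

/-- The cell of a point when there are `k` cells along a side of the unit square. -/
def cell (k : ℕ) (x : Plane) : ℤ × ℤ := (⌊(k : ℝ) * x 0⌋, ⌊(k : ℝ) * x 1⌋)

/-- The second cell is the first one or shares a side with it. -/
def SameOrAdjacent (c c' : ℤ × ℤ) : Prop := |c.1 - c'.1| + |c.2 - c'.2| ≤ 1

/-- The second cell lies in the block of nine cells centred at the first one. -/
def InNineBlock (c c' : ℤ × ℤ) : Prop := |c.1 - c'.1| ≤ 1 ∧ |c.2 - c'.2| ≤ 1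

/-- The time-division class, in `{0, …, 8}`, of a cell: two cells are in the same class iff their
offset is a multiple of three cells in both directions. -/
def tdmaClass (c : ℤ × ℤ) : ℤ := 3 * (c.1 % 3) + c.2 % 3

/-- The next cell on the way from `c` to `d`: first along the horizontal data path (within the row
of the source), then along the vertical one (within the column of the destination). -/
def nextCell (c d : ℤ × ℤ) : ℤ × ℤ :=
  if c.1 < d.1 then (c.1 + 1, c.2)
  else if d.1 < c.1 then (c.1 - 1, c.2)
  else if c.2 < d.2 then (c.1, c.2 + 1)
  else if d.2 < c.2 then (c.1, c.2 - 1)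
  else c

/-- A single hop is at most as long as the diagonal of a cell. -/
def HopLengthOK (k : ℕ) (x y : Plane) : Prop := dist x y ≤ √2 / k

/-! ## Channel -/

/-- The channel power gain at distance `d`. -/
def gain (α d : ℝ) : ℝ := d ^ (-α)

/-- The power `Q d ^ α` with which a node transmits over the distance `d`. -/
def txPower (Q α d : ℝ) : ℝ := Q * d ^ α

/-- The power received at `z` from a transmission from `x` to `y`. -/
def receivedPower (Q α : ℝ) (x y z : Plane) : ℝ := txPower Q α (dist x y) * gain α (dist x z)

/-- Capacity of the Gaussian channel, in bits per second per hertz. -/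
def capacity (snr : ℝ) : ℝ := Real.logb 2 (1 + snr)

/-! ## The primary network: direct multihop routing -/

/-- A way of operating the primary network on one realization. The `j`-th pair uses the nodes
`node j 0, …, node j (len j)`, where hop `h < len j` leads from `node j h` to `node j (h + 1)`. Time
is divided into frames of `9 * rounds` slots; in every frame, hop `h` of pair `j` is served once,
in the slot number `slot j h` of the frame. -/
structure Strategy where
  len : ℕ → ℕ
  node : ℕ → ℕ → ℕ
  rounds : ℕ
  slot : ℕ → ℕ → ℕ

/-- All (pair, hop) combinations of a strategy. -/
def Strategy.hops (σ : Strategy) (ω : Config) : Finset (ℕ × ℕ) :=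
  (Finset.range (numPairs ω)).biUnion fun j => (Finset.range (σ.len j)).image fun h => (j, h)

/-- The position of the transmitter of a hop. -/
def Strategy.tx (σ : Strategy) (ω : Config) (p : ℕ × ℕ) : Plane := ω.2 (σ.node p.1 p.2)

/-- The position of the receiver of a hop. -/
def Strategy.rx (σ : Strategy) (ω : Config) (p : ℕ × ℕ) : Plane := ω.2 (σ.node p.1 (p.2 + 1))

/-- The hops served at time `t` (the frame is repeated forever). -/
def Strategy.active (σ : Strategy) (ω : Config) (t : ℕ) : Finset (ℕ × ℕ) :=
  (σ.hops ω).filter fun p => σ.slot p.1 p.2 = t % (9 * σ.rounds)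

/-- `σ` is a direct multihop operation of the primary network with `k` cells along a side. -/
structure IsDirectMultihop (P α : ℝ) (k : ℕ) (ω : Config) (σ : Strategy) : Prop where
  rounds_pos : 0 < σ.rounds
  /-- the routes use existing nodes only, -/
  node_lt : ∀ j < numPairs ω, ∀ h ≤ σ.len j, σ.node j h < ω.1
  /-- start at the source -/
  source : ∀ j < numPairs ω, σ.node j 0 = 2 * j
  /-- and end at the destination. -/
  destination : ∀ j < numPairs ω, σ.node j (σ.len j) = 2 * j + 1
  /-- A hop stays in its cell or leads to the next cell on the horizontal and then the vertical
  data path of the pair. -/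
  follows_path : ∀ p ∈ σ.hops ω,
    cell k (σ.rx ω p) = cell k (σ.tx ω p) ∨
    cell k (σ.rx ω p) = nextCell (cell k (σ.tx ω p)) (cell k (ω.2 (2 * p.1 + 1)))
  hop_length : ∀ p ∈ σ.hops ω, HopLengthOK k (σ.tx ω p) (σ.rx ω p)
  /-- The transmit power constraint. -/
  power_le : ∀ p ∈ σ.hops ω, txPower P α (dist (σ.tx ω p) (σ.rx ω p)) ≤ P
  slot_lt : ∀ p ∈ σ.hops ω, σ.slot p.1 p.2 < 9 * σ.rounds
  /-- A cell transmits only in the one out of nine slots in which it is activated. -/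
  tdma : ∀ p ∈ σ.hops ω, ((σ.slot p.1 p.2 : ℕ) : ℤ) % 9 = tdmaClass (cell k (σ.tx ω p))
  /-- An active cell serves one hop at a time; the hops served by a cell take turns. -/
  one_per_cell : ∀ p ∈ σ.hops ω, ∀ q ∈ σ.hops ω, σ.slot p.1 p.2 = σ.slot q.1 q.2 →
    cell k (σ.tx ω p) = cell k (σ.tx ω q) → p = q

/-! ## The secondary network -/

/-- The transmissions of the secondary network in one slot, as (transmitter, receiver) pairs of
secondary nodes. -/
abbrev Transmissions : Type := Finset (ℕ × ℕ)

/-- The point `x` lies in the preservation region (nine secondary cells) of a primary node. Here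
`k` is the number of secondary cells along a side. -/
def InPreservationRegion (k : ℕ) (ω : Config) (x : Plane) : Prop :=
  ∃ i < ω.1, InNineBlock (cell k (ω.2 i)) (cell k x)

/-- The rules of the secondary protocol for a single slot, where `ω` and `ω'` are the realizations
of the primary and of the secondary network. Any order of activation of the nine classes, any
repetition of transmissions, and any choice of routes around the preservation regions is allowed
from slot to slot. -/
structure SecondaryAdmissible (k : ℕ) (ω ω' : Config) (B : Transmissions) : Prop where
  node_lt : ∀ b ∈ B, b.1 < ω'.1 ∧ b.2 < ω'.1
  /-- Nine-slot time division: all active cells are in the same class. -/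
  tdma : ∀ b ∈ B, ∀ b' ∈ B, tdmaClass (cell k (ω'.2 b.1)) = tdmaClass (cell k (ω'.2 b'.1))
  one_per_cell : ∀ b ∈ B, ∀ b' ∈ B, cell k (ω'.2 b.1) = cell k (ω'.2 b'.1) → b = b'
  adjacent : ∀ b ∈ B, SameOrAdjacent (cell k (ω'.2 b.1)) (cell k (ω'.2 b.2))
  hop_length : ∀ b ∈ B, HopLengthOK k (ω'.2 b.1) (ω'.2 b.2)
  /-- The secondary paths avoid the preservation regions. -/
  avoids : ∀ b ∈ B, ¬ InPreservationRegion k ω (ω'.2 b.1) ∧ ¬ InPreservationRegion k ω (ω'.2 b.2)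

/-! ## Rates and throughputs -/

/-- The interference at `z` from the secondary network, whose nodes transmit over the distance `d`
with power `δP * P * d ^ α`. -/
def secondaryInterference (P α δP : ℝ) (ω' : Config) (B : Transmissions) (z : Plane) : ℝ :=
  ∑ b ∈ B, receivedPower (δP * P) α (ω'.2 b.1) (ω'.2 b.2) z

/-- The interference at `z`, at time `t`, from the primary transmissions other than hop `p`. -/
def primaryInterference (P α : ℝ) (ω : Config) (σ : Strategy) (t : ℕ) (p : ℕ × ℕ) (z : Plane) : ℝ :=
  ∑ q ∈ (σ.active ω t).erase p, receivedPower P α (σ.tx ω q) (σ.rx ω q) z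

/-- The rate of the primary hop `p` at time `t` when the additional interference at its receiver
from the secondary network is `J`. -/
def hopRate (P N0 α : ℝ) (ω : Config) (σ : Strategy) (t : ℕ) (p : ℕ × ℕ) (J : ℝ) : ℝ :=
  capacity (receivedPower P α (σ.tx ω p) (σ.rx ω p) (σ.rx ω p) /
    (N0 + primaryInterference P α ω σ t p (σ.rx ω p) + J))

/-- Every primary pair communicates at rate `T` while the secondary network behaves as `B`: each
hop of each pair carries, in every frame, `T` per slot of the frame. -/
def PrimaryRateAtLeast (P N0 α δP : ℝ) (ω : Config) (σ : Strategy)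
    (ω' : Config) (B : ℕ → Transmissions) (T : ℝ) : Prop :=
  ∀ p ∈ σ.hops ω, ∀ f : ℕ,
    let t := 9 * σ.rounds * f + σ.slot p.1 p.2
    T * (9 * σ.rounds : ℕ) ≤
      hopRate P N0 α ω σ t p (secondaryInterference P α δP ω' (B t) (σ.rx ω p))

/-- The strategy gives every primary pair the throughput `T` while the secondary network is
silent. -/
def AchievesAlone (P N0 α : ℝ) (ω : Config) (σ : Strategy) (T : ℝ) : Prop :=
  PrimaryRateAtLeast P N0 α 0 ω σ ω (fun _ => ∅) T

/-- The strategy gives every primary pair the throughput `T` in the presence of the secondary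
network `ω'` with `k'` cells along a side, however the latter behaves under its protocol. -/
def AchievesInPresence (P N0 α δP : ℝ) (k' : ℕ) (ω : Config) (σ : Strategy) (ω' : Config)
    (T : ℝ) : Prop :=
  ∀ B : ℕ → Transmissions, (∀ t, SecondaryAdmissible k' ω ω' (B t)) →
    PrimaryRateAtLeast P N0 α δP ω σ ω' B T

/-- The sum throughput belonging to the per-node throughput `T`. -/
def sumThroughput (ω : Config) (T : ℝ) : ℝ := T * numPairs ω

/-- The event `good n` on the realizations of a primary network of density `n` and a secondary
network of density `n ^ β` has (inner) probability tending to one as `n → ∞`. -/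
def WHP (β : ℝ) (good : ℝ → Set (Config × Config)) : Prop :=
  Tendsto (fun n : ℝ => ((poissonNetwork n).prod (poissonNetwork (n ^ β))) (good n)ᶜ) atTop (𝓝 0)

/-! ## Constants -/

/-- The interference constant `P 2 ^ (α / 2 + 3) ∑_{t ≥ 1} t (3 t - 2) ^ (-α)`. -/
def interferenceConst (P α : ℝ) : ℝ :=
  P * 2 ^ (α / 2 + 3) * ∑' s : ℕ, ((s : ℝ) + 1) * (3 * ((s : ℝ) + 1) - 2) ^ (-α)

/-- The largest power factor of the secondary network. -/
def deltaPMax (P N0 α δloss : ℝ) : ℝ :=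
  (1 / ((1 + P / N0) ^ (1 - δloss) - 1) - N0 / P) * (P / interferenceConst P α)

/-- The constant `K_p`. -/
def Kp (P N0 α : ℝ) : ℝ := 1 / 9 * capacity (P / (N0 + interferenceConst P α))

/-- The stand-alone per-node throughput. -/
def Talone (P N0 α n : ℝ) : ℝ := Kp P N0 α / (4 * √2) * (1 / √(n * Real.log n))

/-- The stand-alone sum throughput. -/
def Salone (P N0 α ε n : ℝ) : ℝ := Kp P N0 α * (1 - ε) / (8 * √2) * √(n / Real.log n)

end CognitiveNetwork

end

open CognitiveNetwork

open MeasureTheory Filter Topology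

namespace CognitiveNetwork

/-! ## Interference -/

/-! Interference. The cells active in one slot form a translate of the lattice of cells with both
offsets divisible by 3. Around a reference cell of the class, ring `t` has `8 * t` of them, and a
receiver at most one cell away from the reference cell is at least `3 * t - 2` cell sides from each.
Since the transmit power is proportional to `d ^ α` with `d` at most the cell diagonal, the cell
size cancels, and summing over the rings gives at most `interferenceConst` (`sum_receivedPower_le`).
The same bound holds for both networks: the reference cell is the transmitter's own cell for a
primary hop, and for the secondary network the unique cell of the active class inside the
preservation region of the receiver, where nobody transmits. So the secondary network adds at most
`δP` times the constant, whatever its density and behaviour.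

Rate loss. `deltaPMax` is the power factor at which the fraction `δloss` of the rate is lost when
noise is the only other disturbance. As `x ↦ log (1 + P / x)` is log-convex, extra interference
costs relatively less on top of a larger `x`, so adding the primary interference does no harm
(`one_sub_mul_capacity_le`).

Routing. Nodes of adjacent cells can be farther apart than a cell diagonal, but nodes in the two
halves facing each other cannot. If every half cell is occupied, a route needs at most two
transmissions per cell: one to a node in the right half, one across the edge. A cell only carries
pairs with source in its row or destination in its column. With at most `L` of each kind it handles
at most `4 * L` hops, so frames of `9 * (4 * L)` slots suffice (`GoodPlacement.exists_strategy`).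

Probability. A half cell has mean occupancy at least `log n`, so it is empty with probability at
most `1 / n`, and there are only of order `n / log n` of them. Poisson tail bounds control the
number of nodes, and Chebyshev's inequality gives `L = loadBound n` for all rows and columns. Only
the primary placement enters the exceptional event. -/

lemma summable_interference {α : ℝ} (hα : 2 < α) :
    Summable fun s : ℕ => ((s : ℝ) + 1) * (3 * ((s : ℝ) + 1) - 2) ^ (-α) := by
  have h : Summable fun s : ℕ => ((s + 1 : ℕ) : ℝ) ^ (1 - α) :=
    (summable_nat_add_iff 1).2 (Real.summable_nat_rpow.2 (by linarith))
  refine h.of_nonneg_of_le (fun s => ?_) fun s => ?_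
  · have : (0 : ℝ) ≤ 3 * ((s : ℝ) + 1) - 2 := by nlinarith [s.cast_nonneg (α := ℝ)]
    positivity
  · have hs : (0 : ℝ) < (s : ℝ) + 1 := by positivity
    have h1 : (3 * ((s : ℝ) + 1) - 2) ^ (-α) ≤ ((s : ℝ) + 1) ^ (-α) :=
      Real.rpow_le_rpow_of_nonpos hs (by nlinarith [s.cast_nonneg (α := ℝ)]) (by linarith)
    calc _ ≤ ((s : ℝ) + 1) * ((s : ℝ) + 1) ^ (-α) := by gcongr
      _ = _ := by
        push_cast
        rw [sub_eq_add_neg, Real.rpow_add hs, Real.rpow_one]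

lemma interferenceConst_pos {P α : ℝ} (hP : 0 < P) (hα : 2 < α) : 0 < interferenceConst P α := by
  have h : (0 : ℝ) < ∑' s : ℕ, ((s : ℝ) + 1) * (3 * ((s : ℝ) + 1) - 2) ^ (-α) := by
    refine (summable_interference hα).tsum_pos (fun s => ?_) 0 (by norm_num)
    have : (0 : ℝ) ≤ 3 * ((s : ℝ) + 1) - 2 := by nlinarith [s.cast_nonneg (α := ℝ)]
    positivity
  unfold interferenceConst
  positivity

lemma interferenceConst_mul (δ P α : ℝ) :
    interferenceConst (δ * P) α = δ * interferenceConst P α := by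
  unfold interferenceConst; ring

lemma receivedPower_nonneg {Q : ℝ} (hQ : 0 ≤ Q) (α : ℝ) (x y z : Plane) :
    0 ≤ receivedPower Q α x y z := by
  unfold receivedPower txPower gain; positivity

/-- Power control compensates the path loss exactly. Distinct points are needed: for `α ≠ 0` the
product is `0` at distance `0`, so hops between coinciding nodes must be excluded later. -/
lemma receivedPower_self {Q α : ℝ} {x y : Plane} (hxy : x ≠ y) : receivedPower Q α x y y = Q := by
  have h : 0 < dist x y := dist_pos.2 hxy
  unfold receivedPower txPower gain
  rw [mul_assoc, ← Real.rpow_add h]; simp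

/-- Hop length and distance are both measured in cell sides, so the powers of `k` cancel. This is
why one constant serves networks of any density. -/
lemma receivedPower_le {Q α : ℝ} {k : ℕ} {x y z : Plane} {r : ℝ} (hQ : 0 ≤ Q) (hα : 0 < α)
    (hk : 0 < k) (hd : dist x y ≤ √2 / k) (hr : 0 < r) (h : r / k ≤ dist x z) :
    receivedPower Q α x y z ≤ Q * 2 ^ (α / 2) * r ^ (-α) := by
  have hk' : (0 : ℝ) < k := by exact_mod_cast hk
  have h1 : dist x y ^ α ≤ (√2 / k) ^ α := Real.rpow_le_rpow dist_nonneg hd hα.le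
  have h2 : dist x z ^ (-α) ≤ (r / k) ^ (-α) :=
    Real.rpow_le_rpow_of_nonpos (by positivity) h (by linarith)
  unfold receivedPower txPower gain
  calc Q * dist x y ^ α * dist x z ^ (-α) ≤ Q * (√2 / k) ^ α * (r / k) ^ (-α) := by gcongr
    _ = Q * 2 ^ (α / 2) * r ^ (-α) := by
      rw [Real.div_rpow (by positivity) hk'.le, Real.div_rpow hr.le hk'.le, Real.sqrt_eq_rpow,
        ← Real.rpow_mul (by norm_num), Real.rpow_neg hk'.le]
      have : (k : ℝ) ^ α ≠ 0 := by positivity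
      rw [show (1 / 2 : ℝ) * α = α / 2 by ring]
      field_simp

lemma abs_sub_apply_le_dist (x z : Plane) (i : Fin 2) : |x i - z i| ≤ dist x z := by
  rw [dist_eq_norm]
  simpa using PiLp.norm_apply_le (x - z) i

lemma div_le_abs_sub_of_floor {k : ℕ} (hk : 0 < k) {x z : ℝ} {m : ℤ}
    (h : m + 1 ≤ |⌊(k : ℝ) * x⌋ - ⌊(k : ℝ) * z⌋|) : (m : ℝ) / k ≤ |x - z| := by
  have hk' : (0 : ℝ) < k := by exact_mod_cast hk
  rw [div_le_iff₀ hk']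
  have hx1 := Int.floor_le ((k : ℝ) * x)
  have hx2 := Int.lt_floor_add_one ((k : ℝ) * x)
  have hz1 := Int.floor_le ((k : ℝ) * z)
  have hz2 := Int.lt_floor_add_one ((k : ℝ) * z)
  rcases le_abs.1 h with h | h
  · have h' : (m : ℝ) + 1 ≤ (⌊(k : ℝ) * x⌋ : ℝ) - ⌊(k : ℝ) * z⌋ := by exact_mod_cast h
    nlinarith [le_abs_self (x - z)]
  · have h' : (m : ℝ) + 1 ≤ -((⌊(k : ℝ) * x⌋ : ℝ) - ⌊(k : ℝ) * z⌋) := by exact_mod_cast h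
    nlinarith [neg_abs_le (x - z)]

/-- Two points whose cells are `m + 1` apart in the maximum norm have distance at least `m / k`. -/
lemma div_le_dist_of_cell {k : ℕ} (hk : 0 < k) {x z : Plane} {m : ℤ}
    (h : m + 1 ≤ |(cell k x).1 - (cell k z).1| ∨ m + 1 ≤ |(cell k x).2 - (cell k z).2|) :
    (m : ℝ) / k ≤ dist x z := by
  rcases h with h | h
  · exact (div_le_abs_sub_of_floor hk h).trans (abs_sub_apply_le_dist x z 0)
  · exact (div_le_abs_sub_of_floor hk h).trans (abs_sub_apply_le_dist x z 1)

/-- The interference from transmitters in distinct cells of one time-division class at a receiver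
near the cell `c₀` of that class, if no transmitter lies in `c₀`. -/
lemma sum_receivedPower_le {ι : Type*} {Q α : ℝ} (hQ : 0 ≤ Q) (hα : 2 < α) {k : ℕ} (hk : 0 < k)
    (s : Finset ι) (u v : ι → Plane) (z : Plane) (c₀ : ℤ × ℤ) (hz : InNineBlock c₀ (cell k z))
    (hmod : ∀ q ∈ s, (3 : ℤ) ∣ (cell k (u q)).1 - c₀.1 ∧ (3 : ℤ) ∣ (cell k (u q)).2 - c₀.2)
    (hne : ∀ q ∈ s, cell k (u q) ≠ c₀)
    (hinj : ∀ q ∈ s, ∀ q' ∈ s, cell k (u q) = cell k (u q') → q = q')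
    (hd : ∀ q ∈ s, dist (u q) (v q) ≤ √2 / k) :
    ∑ q ∈ s, receivedPower Q α (u q) (v q) z ≤ interferenceConst Q α := by
  classical
  set off : ι → ℤ × ℤ := fun q => (((cell k (u q)).1 - c₀.1) / 3, ((cell k (u q)).2 - c₀.2) / 3)
    with hoff
  -- Rings are numbered from `0`, as in the series. The subtraction does not truncate, because the
  -- offset `(0, 0)` is excluded by `hne`.
  set ring : ι → ℕ := fun q => max (off q).1.natAbs (off q).2.natAbs - 1 with hring
  have hcell : ∀ q ∈ s, cell k (u q) = (c₀.1 + 3 * (off q).1, c₀.2 + 3 * (off q).2) := by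
    intro q hq
    obtain ⟨h1, h2⟩ := hmod q hq
    ext <;> simp only [hoff] <;> omega
  have hpos : ∀ q ∈ s, max (off q).1.natAbs (off q).2.natAbs = ring q + 1 := by
    intro q hq
    have h1 := hcell q hq
    have h2 := hne q hq
    have : ¬ ((off q).1 = 0 ∧ (off q).2 = 0) := by
      rintro ⟨h3, h4⟩
      rw [h3, h4] at h1
      exact h2 (by rw [h1]; simp)
    simp only [hring]
    omega
  have hterm : ∀ q ∈ s, receivedPower Q α (u q) (v q) z ≤
      Q * 2 ^ (α / 2) * (3 * ((ring q : ℝ) + 1) - 2) ^ (-α) := by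
    intro q hq
    refine receivedPower_le hQ (by linarith) hk (hd q hq)
      (by nlinarith [(ring q).cast_nonneg (α := ℝ)]) ?_
    -- The transmitter's cell is `3 * (ring q + 1)` from `c₀` in the maximum norm, the receiver's
    -- cell at most `1`; two cells `m + 1` apart guarantee only the distance `m / k`.
    have h := div_le_dist_of_cell hk (x := u q) (z := z) (m := 3 * ((ring q : ℤ) + 1) - 2) ?_
    · exact_mod_cast h
    · have h1 := hcell q hq
      have h2 := hpos q hq
      obtain ⟨h3, h4⟩ := hz
      rw [h1]
      simp only
      rw [abs_le] at h3 h4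
      simp only [le_abs]
      omega
  have hcard : ∀ t : ℕ, ((s.filter fun q => ring q = t).card : ℝ) ≤ 8 * ((t : ℝ) + 1) := by
    intro t
    have h : (s.filter fun q => ring q = t).card ≤ (Finset.box (t + 1) : Finset (ℤ × ℤ)).card := by
      refine Finset.card_le_card_of_injOn off ?_ ?_
      · intro q hq
        simp only [Finset.coe_filter, Set.mem_ofPred_eq] at hq
        simp only [Finset.mem_coe, Int.mem_box, hpos q hq.1, hq.2]
      · intro q hq q' hq' h
        simp only [Finset.coe_filter, Set.mem_ofPred_eq] at hq hq'
        exact hinj q hq.1 q' hq'.1 (by rw [hcell q hq.1, hcell q' hq'.1, h])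
    rw [Int.card_box (by omega)] at h
    exact_mod_cast h
  obtain ⟨M, hM⟩ : ∃ M : ℕ, ∀ q ∈ s, ring q ∈ Finset.range M :=
    ⟨(s.sup ring) + 1, fun q hq => by
      simpa [Nat.lt_succ_iff] using Finset.le_sup (f := ring) hq⟩
  have hnn : ∀ t : ℕ, (0 : ℝ) ≤ (3 * ((t : ℝ) + 1) - 2) ^ (-α) := fun t =>
    Real.rpow_nonneg (by nlinarith [t.cast_nonneg (α := ℝ)]) _
  calc ∑ q ∈ s, receivedPower Q α (u q) (v q) z
      ≤ ∑ q ∈ s, Q * 2 ^ (α / 2) * (3 * ((ring q : ℝ) + 1) - 2) ^ (-α) := Finset.sum_le_sum hterm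
    _ = ∑ t ∈ Finset.range M, ∑ q ∈ s with ring q = t,
          Q * 2 ^ (α / 2) * (3 * ((ring q : ℝ) + 1) - 2) ^ (-α) :=
        (Finset.sum_fiberwise_of_maps_to hM _).symm
    _ = ∑ t ∈ Finset.range M, ((s.filter fun q => ring q = t).card : ℝ) *
          (Q * 2 ^ (α / 2) * (3 * ((t : ℝ) + 1) - 2) ^ (-α)) := by
        refine Finset.sum_congr rfl fun t _ => ?_
        rw [← nsmul_eq_mul, ← Finset.sum_const]
        refine Finset.sum_congr rfl fun q hq => ?_
        rw [(Finset.mem_filter.1 hq).2]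
    _ ≤ ∑ t ∈ Finset.range M, 8 * ((t : ℝ) + 1) *
          (Q * 2 ^ (α / 2) * (3 * ((t : ℝ) + 1) - 2) ^ (-α)) := by
        refine Finset.sum_le_sum fun t _ => mul_le_mul_of_nonneg_right (hcard t) ?_
        have := hnn t
        positivity
    _ = Q * 2 ^ (α / 2 + 3) * ∑ t ∈ Finset.range M,
          ((t : ℝ) + 1) * (3 * ((t : ℝ) + 1) - 2) ^ (-α) := by
        rw [Finset.mul_sum, Real.rpow_add (by norm_num)]
        refine Finset.sum_congr rfl fun t _ => ?_
        norm_num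
        ring_nf
    _ ≤ interferenceConst Q α := by
        unfold interferenceConst
        gcongr
        exact (summable_interference hα).sum_le_tsum _ fun t _ => mul_nonneg (by positivity) (hnn t)

lemma tdmaClass_eq_iff {c c' : ℤ × ℤ} :
    tdmaClass c = tdmaClass c' ↔ (3 : ℤ) ∣ c'.1 - c.1 ∧ (3 : ℤ) ∣ c'.2 - c.2 := by
  unfold tdmaClass; omega

lemma inNineBlock_nextCell (c d : ℤ × ℤ) : InNineBlock c (nextCell c d) := by
  unfold InNineBlock nextCell
  split_ifs <;> simp

lemma inNineBlock_self (c : ℤ × ℤ) : InNineBlock c c := by simp [InNineBlock]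

/-! ### Worst-case interference and rates of the primary network -/

section Primary

variable {P α : ℝ} {k : ℕ} {ω : Config} {σ : Strategy}

lemma IsDirectMultihop.primaryInterference_le (hσ : IsDirectMultihop P α k ω σ) (hP : 0 < P)
    (hα : 2 < α) (hk : 0 < k) {p : ℕ × ℕ} (hp : p ∈ σ.hops ω) (f : ℕ) :
    primaryInterference P α ω σ (9 * σ.rounds * f + σ.slot p.1 p.2) p (σ.rx ω p) ≤
      interferenceConst P α := by
  have hact : ∀ q ∈ (σ.active ω (9 * σ.rounds * f + σ.slot p.1 p.2)).erase p,
      q ≠ p ∧ q ∈ σ.hops ω ∧ σ.slot q.1 q.2 = σ.slot p.1 p.2 := by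
    intro q hq
    simp only [Strategy.active, Finset.mem_erase, Finset.mem_filter] at hq
    rw [Nat.mul_add_mod, Nat.mod_eq_of_lt (hσ.slot_lt p hp)] at hq
    exact hq
  refine sum_receivedPower_le hP.le hα hk _ (σ.tx ω) (σ.rx ω) _ (cell k (σ.tx ω p)) ?_ ?_ ?_ ?_ ?_
  · rcases hσ.follows_path p hp with h | h <;> rw [h]
    · exact inNineBlock_self _
    · exact inNineBlock_nextCell _ _
  · intro q hq
    obtain ⟨-, hq, hs⟩ := hact q hq
    rw [← tdmaClass_eq_iff, ← hσ.tdma p hp, ← hσ.tdma q hq, hs]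
  · intro q hq h
    obtain ⟨hne, hq, hs⟩ := hact q hq
    exact hne (hσ.one_per_cell q hq p hp hs h)
  · intro q hq q' hq' h
    obtain ⟨-, hq, hs⟩ := hact q hq
    obtain ⟨-, hq', hs'⟩ := hact q' hq'
    exact hσ.one_per_cell q hq q' hq' (hs.trans hs'.symm) h
  · intro q hq
    exact hσ.hop_length q (hact q hq).2.1

/-- The nine cells around a primary node contain exactly one cell of the active class. It takes the
part of the reference cell, and the preservation region keeps it free of transmitters. -/
lemma SecondaryAdmissible.secondaryInterference_le {δP : ℝ} {ω' : Config} {B : Transmissions}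
    (hB : SecondaryAdmissible k ω ω' B) (hP : 0 < P) (hδ : 0 ≤ δP) (hα : 2 < α) {i : ℕ}
    (hi : i < ω.1) :
    secondaryInterference P α δP ω' B (ω.2 i) ≤ δP * interferenceConst P α := by
  rw [← interferenceConst_mul]
  have hQ : 0 ≤ δP * P := by positivity
  rcases B.eq_empty_or_nonempty with rfl | ⟨b₀, hb₀⟩
  · have := interferenceConst_pos hP hα
    simp only [secondaryInterference, Finset.sum_empty, interferenceConst_mul]
    positivity
  have havoid : ∀ b ∈ B, ¬ InNineBlock (cell k (ω.2 i)) (cell k (ω'.2 b.1)) := fun b hb h =>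
    (hB.avoids b hb).1 ⟨i, hi, h⟩
  -- With `k = 0` all points share one cell, so no transmitter can avoid the preservation region.
  rcases Nat.eq_zero_or_pos k with rfl | hk
  · exact absurd (by simp [InNineBlock, cell]) (havoid b₀ hb₀)
  set z := cell k (ω.2 i)
  set c := cell k (ω'.2 b₀.1)
  -- Each coordinate of `c` is reduced modulo 3 to a representative within distance `1` of that of
  -- `z`.
  set c₀ : ℤ × ℤ := (z.1 + ((c.1 - z.1 + 1) % 3 - 1), z.2 + ((c.2 - z.2 + 1) % 3 - 1)) with hc₀
  have hz : InNineBlock c₀ z ∧ InNineBlock z c₀ := by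
    unfold InNineBlock
    simp only [hc₀, abs_le]
    omega
  refine sum_receivedPower_le hQ hα hk _ _ _ _ c₀ hz.1 ?_ ?_ ?_ ?_
  · intro b hb
    have h : (3 : ℤ) ∣ (cell k (ω'.2 b.1)).1 - c.1 ∧ (3 : ℤ) ∣ (cell k (ω'.2 b.1)).2 - c.2 :=
      tdmaClass_eq_iff.1 (hB.tdma b₀ hb₀ b hb)
    simp only [hc₀]
    omega
  · intro b hb h
    exact havoid b hb (h ▸ hz.2)
  · intro b hb b' hb' h
    exact hB.one_per_cell b hb b' hb' h
  · intro b hb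
    exact hB.hop_length b hb

lemma Strategy.mem_hops {p : ℕ × ℕ} : p ∈ σ.hops ω ↔ p.1 < numPairs ω ∧ p.2 < σ.len p.1 := by
  obtain ⟨j, h⟩ := p
  simp only [Strategy.hops, Finset.mem_biUnion, Finset.mem_range, Finset.mem_image, Prod.mk.injEq]
  constructor
  · rintro ⟨_, h1, _, h2, rfl, rfl⟩; exact ⟨h1, h2⟩
  · rintro ⟨h1, h2⟩; exact ⟨_, h1, _, h2, rfl, rfl⟩

/-- If the hops have positive length, a direct multihop operation provides the rates given by the
worst-case interference. -/
lemma IsDirectMultihop.primaryRateAtLeast {N0 δP J T : ℝ} {ω' : Config} {B : ℕ → Transmissions}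
    (hσ : IsDirectMultihop P α k ω σ) (hP : 0 < P) (hN0 : 0 < N0) (hα : 2 < α) (hk : 0 < k)
    (hne : ∀ p ∈ σ.hops ω, σ.tx ω p ≠ σ.rx ω p) (hδ : 0 ≤ δP)
    (hJ : ∀ t, ∀ i < ω.1, secondaryInterference P α δP ω' (B t) (ω.2 i) ≤ J)
    (hT : T * (9 * σ.rounds : ℕ) ≤ capacity (P / (N0 + interferenceConst P α + J))) :
    PrimaryRateAtLeast P N0 α δP ω σ ω' B T := by
  intro p hp f
  refine hT.trans ?_
  obtain ⟨hp1, hp2⟩ := Strategy.mem_hops.1 hp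
  have hI := hσ.primaryInterference_le hP hα hk hp f
  have hI0 : 0 ≤ primaryInterference P α ω σ (9 * σ.rounds * f + σ.slot p.1 p.2) p (σ.rx ω p) :=
    Finset.sum_nonneg fun q _ => receivedPower_nonneg hP.le _ _ _ _
  have hS := hJ (9 * σ.rounds * f + σ.slot p.1 p.2) _ (hσ.node_lt p.1 hp1 (p.2 + 1) hp2)
  have hS0 : 0 ≤ secondaryInterference P α δP ω' (B (9 * σ.rounds * f + σ.slot p.1 p.2))
      (σ.rx ω p) :=
    Finset.sum_nonneg fun q _ => receivedPower_nonneg (by positivity) _ _ _ _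
  change secondaryInterference P α δP ω' (B (9 * σ.rounds * f + σ.slot p.1 p.2)) (σ.rx ω p) ≤ J
    at hS
  unfold hopRate capacity
  rw [receivedPower_self (hne p hp)]
  refine Real.logb_le_logb_of_le (by norm_num) ?_ ?_
  · have : 0 < N0 + interferenceConst P α + J := by
      have := interferenceConst_pos hP hα
      linarith
    positivity
  · gcongr

end Primary

/-! ## The rate loss caused by additional interference -/

/-- The logarithmic derivative of `x ↦ log (1 + P / x)` is `-P` divided by this function, so its
monotonicity is the log-convexity needed below. -/
lemma mul_log_one_add_div_mono {P : ℝ} (hP : 0 < P) :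
    MonotoneOn (fun x : ℝ => x * (x + P) * Real.log (1 + P / x)) (Set.Ioi 0) := by
  have hder : ∀ x ∈ Set.Ioi (0 : ℝ), HasDerivAt (fun x : ℝ => x * (x + P) * Real.log (1 + P / x))
      ((2 * x + P) * Real.log (1 + P / x) - P) x := by
    intro x hx
    have hx : 0 < x := hx
    have h1 : HasDerivAt (fun x : ℝ => x * (x + P)) (2 * x + P) x := by
      have := (hasDerivAt_id x).mul ((hasDerivAt_id x).add_const P)
      refine (this.congr_deriv ?_)
      simp; ring
    have h2 : HasDerivAt (fun x : ℝ => 1 + P / x) (-P / x ^ 2) x := by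
      have := ((hasDerivAt_inv hx.ne').const_mul P).const_add 1
      refine (this.congr_deriv ?_).congr_of_eventuallyEq ?_
      · field_simp
      · exact Filter.Eventually.of_forall fun y => by simp [div_eq_mul_inv]
    have h3 := h2.log (by positivity)
    refine (h1.mul h3).congr_deriv ?_
    have : x + P ≠ 0 := by positivity
    field_simp
    ring
  refine monotoneOn_of_deriv_nonneg (convex_Ioi 0)
    (fun x hx => (hder x hx).continuousAt.continuousWithinAt) ?_ ?_
  · rw [interior_Ioi]
    exact fun x hx => (hder x hx).differentiableAt.differentiableWithinAt
  · rw [interior_Ioi]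
    intro x hx
    rw [(hder x hx).deriv]
    have hx : 0 < x := hx
    -- From `1 - 1 / y ≤ log y` at `y = 1 + P / x`; the derivative is then at least `x * P / (x +
    -- P)`.
    have h : P / (x + P) ≤ Real.log (1 + P / x) := by
      have := Real.one_sub_inv_le_log_of_pos (x := 1 + P / x) (by positivity)
      refine le_trans (le_of_eq ?_) this
      field_simp
      ring
    have h2 : P ≤ (2 * x + P) * (P / (x + P)) := by
      rw [mul_div_assoc', le_div_iff₀ (by positivity)]
      nlinarith [mul_pos hx hP]
    nlinarith

/-- The function `x ↦ log (1 + P / x)` is log-convex. -/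
lemma log_one_add_div_mul_le {P x I J : ℝ} (hP : 0 < P) (hx : 0 < x) (hI : 0 ≤ I) (hJ : 0 ≤ J) :
    Real.log (1 + P / (x + I)) * Real.log (1 + P / (x + J)) ≤
      Real.log (1 + P / x) * Real.log (1 + P / (x + I + J)) := by
  have hgpos : ∀ y : ℝ, 0 < y → 0 < Real.log (1 + P / y) := fun y hy =>
    Real.log_pos (by have : 0 < P / y := by positivity
                     linarith)
  have hg : ∀ y : ℝ, 0 < y → HasDerivAt (fun y : ℝ => Real.log (Real.log (1 + P / y)))
      (-P / (y * (y + P) * Real.log (1 + P / y))) y := by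
    intro y hy
    have h2 : HasDerivAt (fun x : ℝ => 1 + P / x) (-P / y ^ 2) y := by
      have := ((hasDerivAt_inv hy.ne').const_mul P).const_add 1
      refine (this.congr_deriv ?_).congr_of_eventuallyEq ?_
      · field_simp
      · exact Filter.Eventually.of_forall fun y => by simp [div_eq_mul_inv]
    have h3 := (h2.log (by positivity)).log (hgpos y hy).ne'
    refine h3.congr_deriv ?_
    have : y + P ≠ 0 := by positivity
    have := (hgpos y hy).ne'
    field_simp
  -- The claim is `F x ≤ F (x + I)` after taking logarithms: the rate ratio caused by adding `J`
  -- increases with `x`.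
  set F : ℝ → ℝ := fun y => Real.log (Real.log (1 + P / (y + J))) - Real.log (Real.log (1 + P / y))
    with hF
  have hFd : ∀ y : ℝ, 0 < y → HasDerivAt F
      (-P / ((y + J) * (y + J + P) * Real.log (1 + P / (y + J))) -
        -P / (y * (y + P) * Real.log (1 + P / y))) y := fun y hy =>
    ((hg (y + J) (by positivity)).comp_add_const y J).sub (hg y hy)
  have hmono : MonotoneOn F (Set.Ioi 0) := by
    refine monotoneOn_of_deriv_nonneg (convex_Ioi 0)
      (fun x hx => (hFd x hx).continuousAt.continuousWithinAt) ?_ ?_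
    · rw [interior_Ioi]
      exact fun x hx => (hFd x hx).differentiableAt.differentiableWithinAt
    · rw [interior_Ioi]
      intro y hy
      rw [(hFd y hy).deriv]
      have hy : 0 < y := hy
      have h := mul_log_one_add_div_mono hP (a := y) (b := y + J) hy
        (show (0 : ℝ) < y + J by positivity) (by linarith)
      simp only at h
      have hpos := hgpos y hy
      have : P / ((y + J) * (y + J + P) * Real.log (1 + P / (y + J))) ≤
          P / (y * (y + P) * Real.log (1 + P / y)) := by gcongr
      rw [neg_div, neg_div]
      linarith
  have h := hmono (a := x) (b := x + I) hx (show (0 : ℝ) < x + I by positivity) (by linarith)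
  have e1 := hgpos (x + I) (by positivity)
  have e2 := hgpos (x + J) (by positivity)
  have e3 := hgpos x hx
  have e4 := hgpos (x + I + J) (by positivity)
  rw [← Real.log_le_log_iff (by positivity) (by positivity), Real.log_mul e1.ne' e2.ne',
    Real.log_mul e3.ne' e4.ne']
  simp only [hF] at h
  linarith

/-- Below `deltaPMax`, the secondary interference costs at most the fraction `δloss` of the
rate. -/
lemma one_sub_mul_capacity_le {P N0 α δloss δP : ℝ} (hP : 0 < P) (hN0 : 0 < N0) (hα : 2 < α)
    (hloss : δloss ∈ Set.Ioo (0 : ℝ) 1) (hδ : 0 ≤ δP) (hmax : δP ≤ deltaPMax P N0 α δloss) :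
    (1 - δloss) * capacity (P / (N0 + interferenceConst P α)) ≤
      capacity (P / (N0 + interferenceConst P α + δP * interferenceConst P α)) := by
  have hI := interferenceConst_pos hP hα
  set I := interferenceConst P α with hIdef
  have hJ : 0 ≤ δP * I := by positivity
  have hb : (1 : ℝ) < 1 + P / N0 := by
    have : 0 < P / N0 := by positivity
    linarith
  have hA : 1 < (1 + P / N0) ^ (1 - δloss) :=
    Real.one_lt_rpow hb (by linarith [hloss.2])
  -- The definition of `deltaPMax`, solved for the rate without primary interference.
  have h1 : (1 + P / N0) ^ (1 - δloss) ≤ 1 + P / (N0 + δP * I) := by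
    unfold deltaPMax at hmax
    rw [← hIdef] at hmax
    set A := (1 + P / N0) ^ (1 - δloss) - 1 with hAdef
    have hA' : 0 < A := by linarith
    have : δP * I ≤ P / A - N0 := by
      calc δP * I ≤ ((1 / A - N0 / P) * (P / I)) * I := by gcongr
        _ = P / A - N0 := by field_simp
    have h2 : N0 + δP * I ≤ P / A := by linarith
    have h3 : A ≤ P / (N0 + δP * I) := by
      rw [le_div_iff₀ (by positivity)]
      rw [le_div_iff₀ hA'] at h2
      linarith
    linarith
  have h2 : (1 - δloss) * Real.log (1 + P / N0) ≤ Real.log (1 + P / (N0 + δP * I)) := by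
    rw [← Real.log_rpow (by positivity)]
    exact Real.log_le_log (by positivity) h1
  -- Log-convexity transfers the bound from the level `N0` to `N0 + I`; the common factor `log (1 +
  -- P / N0)` is cancelled afterwards.
  have h3 := log_one_add_div_mul_le hP hN0 hI.le hJ
  have e0 : 0 < Real.log (1 + P / N0) := Real.log_pos hb
  have e1 : 0 ≤ Real.log (1 + P / (N0 + I)) := Real.log_nonneg (by
    have : 0 < P / (N0 + I) := by positivity
    linarith)
  have h4 : (1 - δloss) * Real.log (1 + P / (N0 + I)) ≤ Real.log (1 + P / (N0 + I + δP * I)) := by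
    refine le_of_mul_le_mul_left ?_ e0
    nlinarith
  unfold capacity Real.logb
  rw [mul_div_assoc']
  gcongr

/-! ## Geometry of cells -/

/-- The point `x` lies in the half of the cell `c` that is turned towards the neighbouring cell
`c'`. -/
def Toward (k : ℕ) (c c' : ℤ × ℤ) (x : Plane) : Prop :=
  cell k x = c ∧ 0 ≤ ((k : ℝ) * x 0 - c.1 - 1 / 2) * (c'.1 - c.1 : ℤ) ∧
    0 ≤ ((k : ℝ) * x 1 - c.2 - 1 / 2) * (c'.2 - c.2 : ℤ)

/-- The cell is one of the `k ^ 2` cells of the unit square. -/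
def InGrid (k : ℕ) (c : ℤ × ℤ) : Prop := (0 ≤ c.1 ∧ c.1 < k) ∧ 0 ≤ c.2 ∧ c.2 < k

/-- The number of steps between two cells. -/
def cellDist (c d : ℤ × ℤ) : ℕ := (c.1 - d.1).natAbs + (c.2 - d.2).natAbs

lemma cellDist_nextCell {c d : ℤ × ℤ} (h : c ≠ d) : cellDist (nextCell c d) d + 1 = cellDist c d := by
  have : ¬ (c.1 = d.1 ∧ c.2 = d.2) := fun h' => h (Prod.ext h'.1 h'.2)
  unfold cellDist nextCell
  split_ifs <;> omega

lemma nextCell_ne {c d : ℤ × ℤ} (h : c ≠ d) : nextCell c d ≠ c := by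
  intro h'
  have := cellDist_nextCell h
  rw [h'] at this
  omega

lemma sameOrAdjacent_nextCell (c d : ℤ × ℤ) : SameOrAdjacent c (nextCell c d) := by
  unfold SameOrAdjacent nextCell
  split_ifs <;> simp

lemma SameOrAdjacent.symm {c c' : ℤ × ℤ} (h : SameOrAdjacent c c') : SameOrAdjacent c' c := by
  unfold SameOrAdjacent at *
  rwa [abs_sub_comm c'.1, abs_sub_comm c'.2]

lemma InGrid.nextCell {k : ℕ} {c d : ℤ × ℤ} (hc : InGrid k c) (hd : InGrid k d) :
    InGrid k (nextCell c d) := by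
  unfold InGrid CognitiveNetwork.nextCell at *
  split_ifs <;> omega

/-- The invariant of a row-then-column path: a vertical step is taken only once the destination's
column is reached. -/
lemma nextCell_snd_eq_or {c d : ℤ × ℤ} {r : ℤ} (h : c.2 = r ∨ c.1 = d.1) :
    (nextCell c d).2 = r ∨ (nextCell c d).1 = d.1 := by
  unfold nextCell
  split_ifs <;> omega

lemma inGrid_cell {k : ℕ} (hk : 0 < k) {x : Plane} (hx : x ∈ unitSquare) : InGrid k (cell k x) := by
  have hk' : (0 : ℝ) < k := by exact_mod_cast hk
  have h : ∀ i, 0 ≤ ⌊(k : ℝ) * x i⌋ ∧ ⌊(k : ℝ) * x i⌋ < k := by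
    intro i
    obtain ⟨h0, h1⟩ := hx i
    refine ⟨Int.floor_nonneg.2 (by positivity), Int.floor_lt.2 ?_⟩
    push_cast
    nlinarith
  exact ⟨h 0, h 1⟩

lemma hopLengthOK_of_abs_le {k : ℕ} {x y : Plane} (h0 : |k * x 0 - k * y 0| ≤ 1)
    (h1 : |(k : ℝ) * x 1 - k * y 1| ≤ 1) (hk : 0 < k) : HopLengthOK k x y := by
  have hk' : (0 : ℝ) < k := by exact_mod_cast hk
  unfold HopLengthOK
  rw [le_div_iff₀ hk', EuclideanSpace.dist_eq, Fin.sum_univ_two]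
  refine Real.le_sqrt_of_sq_le ?_
  rw [mul_pow, Real.sq_sqrt (by positivity), Real.dist_eq, Real.dist_eq, sq_abs, sq_abs]
  have h0' := (sq_le_one_iff_abs_le_one _).2 h0
  have h1' := (sq_le_one_iff_abs_le_one _).2 h1
  nlinarith

/-- Across the common edge each point is at most half a side away from it, and along the edge both
lie in the same strip, so both coordinates differ by at most one side. Arbitrary points of adjacent
cells may be almost `√5 / k` apart. -/
lemma Toward.hopLengthOK {k : ℕ} (hk : 0 < k) {c c' : ℤ × ℤ} (h : SameOrAdjacent c c') {x y : Plane}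
    (hx : Toward k c c' x) (hy : Toward k c' c y) : HopLengthOK k x y := by
  obtain ⟨rfl, hx0, hx1⟩ := hx
  obtain ⟨rfl, hy0, hy1⟩ := hy
  have key : ∀ i : Fin 2, |⌊(k : ℝ) * x i⌋ - ⌊(k : ℝ) * y i⌋| ≤ 1 →
      0 ≤ ((k : ℝ) * x i - ⌊(k : ℝ) * x i⌋ - 1 / 2) * (⌊(k : ℝ) * y i⌋ - ⌊(k : ℝ) * x i⌋ : ℤ) →
      0 ≤ ((k : ℝ) * y i - ⌊(k : ℝ) * y i⌋ - 1 / 2) * (⌊(k : ℝ) * x i⌋ - ⌊(k : ℝ) * y i⌋ : ℤ) →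
      |(k : ℝ) * x i - k * y i| ≤ 1 := by
    intro i h1 h2 h3
    have hx1 := Int.floor_le ((k : ℝ) * x i)
    have hx2 := Int.lt_floor_add_one ((k : ℝ) * x i)
    have hy1 := Int.floor_le ((k : ℝ) * y i)
    have hy2 := Int.lt_floor_add_one ((k : ℝ) * y i)
    generalize ⌊(k : ℝ) * x i⌋ = m at *
    generalize ⌊(k : ℝ) * y i⌋ = l at *
    rw [abs_le] at h1
    obtain rfl | rfl | rfl : l = m ∨ l = m + 1 ∨ l = m - 1 := by omega
    all_goals
      push_cast at *
      rw [abs_le]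
      constructor <;> linarith
  unfold SameOrAdjacent at h
  have a0 := abs_nonneg ((cell k x).1 - (cell k y).1)
  have a1 := abs_nonneg ((cell k x).2 - (cell k y).2)
  exact hopLengthOK_of_abs_le (key 0 (by change |(cell k x).1 - (cell k y).1| ≤ 1; omega) hx0 hy0)
    (key 1 (by change |(cell k x).2 - (cell k y).2| ≤ 1; omega) hx1 hy1) hk

lemma toward_self {k : ℕ} (x : Plane) : Toward k (cell k x) (cell k x) x := by simp [Toward]

lemma hopLengthOK_of_cell_eq {k : ℕ} (hk : 0 < k) {x y : Plane} (h : cell k x = cell k y) :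
    HopLengthOK k x y :=
  -- For `c' = c` the half-cell conditions are void.
  Toward.hopLengthOK hk (c := cell k x) (c' := cell k x) (by simp [SameOrAdjacent]) (toward_self x)
    (h ▸ toward_self y)

/-! ## Routes -/

/-- The properties of a placement of the primary nodes on which the direct multihop operation is
based: all half cells contain nodes, and at most `L` pairs have their source in a given row of cells
or their destination in a given column. -/
structure GoodPlacement (k L : ℕ) (ω : Config) : Prop where
  mem_unitSquare : ∀ i < ω.1, ω.2 i ∈ unitSquare
  inj : ∀ i < ω.1, ∀ j < ω.1, ω.2 i = ω.2 j → i = j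
  exists_toward : ∀ c c', InGrid k c → SameOrAdjacent c c' → c' ≠ c →
    ∃ i < ω.1, Toward k c c' (ω.2 i)
  card_row_le : ∀ r < k,
    ((Finset.range (numPairs ω)).filter fun j => (cell k (ω.2 (2 * j))).2 = r).card ≤ L
  card_col_le : ∀ r < k,
    ((Finset.range (numPairs ω)).filter fun j => (cell k (ω.2 (2 * j + 1))).1 = r).card ≤ L

/-- A route from the node `s` to the node `d` which transmits at most twice in every cell. -/
structure IsRoute (k : ℕ) (ω : Config) (s d len : ℕ) (node : ℕ → ℕ) : Prop where
  source : node 0 = s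
  destination : node len = d
  node_lt : ∀ h, node h < ω.1
  follows_path : ∀ h < len, cell k (ω.2 (node (h + 1))) = cell k (ω.2 (node h)) ∨
    cell k (ω.2 (node (h + 1))) = nextCell (cell k (ω.2 (node h))) (cell k (ω.2 d))
  hop_length : ∀ h < len, HopLengthOK k (ω.2 (node h)) (ω.2 (node (h + 1)))
  ne : ∀ h < len, ω.2 (node h) ≠ ω.2 (node (h + 1))
  row_or_col : ∀ h, (cell k (ω.2 (node h))).2 = (cell k (ω.2 s)).2 ∨
    (cell k (ω.2 (node h))).1 = (cell k (ω.2 d)).1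
  card_le : ∀ c, ((Finset.range len).filter fun h => cell k (ω.2 (node h)) = c).card ≤ 2

section Route

variable (k : ℕ) (ω : Config) (rep : ℤ × ℤ → ℤ × ℤ → ℕ) (d : ℕ)

open Classical in
/-- The node following `u` on the way to `d`, where `rep c c'` is a node in the half of the cell `c`
turned towards `c'`. -/
noncomputable def nextNode (u : ℕ) : ℕ :=
  if cell k (ω.2 u) = cell k (ω.2 d) then d
  else if Toward k (cell k (ω.2 u)) (nextCell (cell k (ω.2 u)) (cell k (ω.2 d))) (ω.2 u) then
    rep (nextCell (cell k (ω.2 u)) (cell k (ω.2 d))) (cell k (ω.2 u))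
  else rep (cell k (ω.2 u)) (nextCell (cell k (ω.2 u)) (cell k (ω.2 d)))

open Classical in
/-- A bound for the number of hops on the way from `u` to `d`. -/
noncomputable def hopBound (u : ℕ) : ℕ :=
  if u = d then 0
  else if cell k (ω.2 u) = cell k (ω.2 d) then 1
  else 2 * cellDist (cell k (ω.2 u)) (cell k (ω.2 d)) +
    if Toward k (cell k (ω.2 u)) (nextCell (cell k (ω.2 u)) (cell k (ω.2 d))) (ω.2 u) then 0 else 1

variable {k ω rep d}

lemma cellDist_self (c : ℤ × ℤ) : cellDist c c = 0 := by simp [cellDist]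

/-- `hopBound` falls strictly along a route, and half of it determines the distance of the current
cell from the destination. Hence only two values are possible while a route is in a given cell,
which limits its transmissions there to two. -/
lemma hopBound_div_two {u : ℕ} (hu : u ≠ d) :
    hopBound k ω d u / 2 = cellDist (cell k (ω.2 u)) (cell k (ω.2 d)) := by
  unfold hopBound
  rw [if_neg hu]
  split_ifs with h1 h2
  · rw [h1, cellDist_self]
  · omega
  · omega

lemma hopBound_le (u : ℕ) :
    hopBound k ω d u ≤ 2 * cellDist (cell k (ω.2 u)) (cell k (ω.2 d)) + 1 := by
  unfold hopBound
  split_ifs <;> omega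

/-- The properties of a single hop of a route. -/
structure IsHop (k : ℕ) (ω : Config) (d u v : ℕ) : Prop where
  follows_path : cell k (ω.2 v) = cell k (ω.2 u) ∨
    cell k (ω.2 v) = nextCell (cell k (ω.2 u)) (cell k (ω.2 d))
  hop_length : HopLengthOK k (ω.2 u) (ω.2 v)
  ne : ω.2 u ≠ ω.2 v
  hopBound_lt : hopBound k ω d v < hopBound k ω d u

lemma nextNode_lt {L : ℕ} (hω : GoodPlacement k L ω) (hk : 0 < k)
    (hrep : ∀ c c', InGrid k c → SameOrAdjacent c c' → c' ≠ c →
      rep c c' < ω.1 ∧ Toward k c c' (ω.2 (rep c c'))) (hd : d < ω.1) {u : ℕ} (hu : u < ω.1) :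
    nextNode k ω rep d u < ω.1 := by
  have hcu := inGrid_cell hk (hω.mem_unitSquare u hu)
  have hcd := inGrid_cell hk (hω.mem_unitSquare d hd)
  unfold nextNode
  split_ifs with h1 h2
  · exact hd
  · exact (hrep _ _ (hcu.nextCell hcd) (sameOrAdjacent_nextCell _ _).symm (nextCell_ne h1).symm).1
  · exact (hrep _ _ hcu (sameOrAdjacent_nextCell _ _) (nextCell_ne h1)).1

/-- Crossing an edge lowers the cell distance `D` by one, so `hopBound` goes from `2 * D` to at most
`2 * (D - 1) + 1`. The preparatory hop inside a cell removes the extra `1`, and its endpoints differ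
because only the second lies in the right half. -/
lemma isHop_nextNode {L : ℕ} (hω : GoodPlacement k L ω) (hk : 0 < k)
    (hrep : ∀ c c', InGrid k c → SameOrAdjacent c c' → c' ≠ c →
      rep c c' < ω.1 ∧ Toward k c c' (ω.2 (rep c c'))) (hd : d < ω.1) {u : ℕ} (hu : u < ω.1)
    (hud : u ≠ d) : IsHop k ω d u (nextNode k ω rep d u) := by
  have hcu := inGrid_cell hk (hω.mem_unitSquare u hu)
  have hcd := inGrid_cell hk (hω.mem_unitSquare d hd)
  unfold nextNode
  split_ifs with h1 h2
  · refine ⟨Or.inl h1.symm, hopLengthOK_of_cell_eq hk h1, fun h => hud (hω.inj u hu d hd h), ?_⟩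
    simp [hopBound, hud, h1]
  · obtain ⟨-, hv⟩ := hrep _ _ (hcu.nextCell hcd) (sameOrAdjacent_nextCell _ _).symm
      (nextCell_ne h1).symm
    refine ⟨Or.inr hv.1, h2.hopLengthOK hk (sameOrAdjacent_nextCell _ _) hv, fun h => ?_, ?_⟩
    · have := hv.1
      rw [← h] at this
      exact nextCell_ne h1 this.symm
    · have hb := hopBound_le (k := k) (ω := ω) (d := d)
        (rep (nextCell (cell k (ω.2 u)) (cell k (ω.2 d))) (cell k (ω.2 u)))
      rw [hv.1] at hb
      have := cellDist_nextCell h1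
      have hb' : hopBound k ω d u = 2 * cellDist (cell k (ω.2 u)) (cell k (ω.2 d)) := by
        simp [hopBound, hud, h1, h2]
      omega
  · obtain ⟨-, hv⟩ := hrep _ _ hcu (sameOrAdjacent_nextCell _ _) (nextCell_ne h1)
    refine ⟨Or.inl hv.1, hopLengthOK_of_cell_eq hk hv.1.symm, fun h => ?_, ?_⟩
    · rw [← h] at hv
      exact h2 hv
    · have hb : hopBound k ω d u = 2 * cellDist (cell k (ω.2 u)) (cell k (ω.2 d)) + 1 := by
        simp [hopBound, hud, h1, h2]
      rw [hb]
      set v := rep (cell k (ω.2 u)) (nextCell (cell k (ω.2 u)) (cell k (ω.2 d))) with hvdef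
      have hvd : v ≠ d := fun h => h1 (by rw [← hv.1, h])
      have : hopBound k ω d v = 2 * cellDist (cell k (ω.2 u)) (cell k (ω.2 d)) := by
        unfold hopBound
        rw [if_neg hvd, hv.1, if_neg h1, if_pos hv, add_zero]
      omega

end Route

/-- In a good placement, any two nodes are connected by a route. -/
lemma GoodPlacement.exists_isRoute {k L : ℕ} {ω : Config} (hω : GoodPlacement k L ω) (hk : 0 < k)
    {s d : ℕ} (hs : s < ω.1) (hd : d < ω.1) : ∃ len node, IsRoute k ω s d len node := by
  classical
  have hex : ∀ c c', ∃ i, InGrid k c → SameOrAdjacent c c' → c' ≠ c →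
      i < ω.1 ∧ Toward k c c' (ω.2 i) := by
    intro c c'
    by_cases h : InGrid k c ∧ SameOrAdjacent c c' ∧ c' ≠ c
    · obtain ⟨i, hi⟩ := hω.exists_toward c c' h.1 h.2.1 h.2.2
      exact ⟨i, fun _ _ _ => hi⟩
    · exact ⟨0, fun h1 h2 h3 => absurd ⟨h1, h2, h3⟩ h⟩
  choose rep hrep using hex
  set next := nextNode k ω rep d with hnext
  have hreach : ∀ b u, hopBound k ω d u ≤ b → u < ω.1 → ∃ h, next^[h] u = d := by
    intro b
    induction b with
    | zero =>
      intro u hb hu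
      by_cases hud : u = d
      · exact ⟨0, hud⟩
      · have := (isHop_nextNode hω hk hrep hd hu hud).hopBound_lt
        omega
    | succ b ih =>
      intro u hb hu
      by_cases hud : u = d
      · exact ⟨0, hud⟩
      · have := (isHop_nextNode hω hk hrep hd hu hud).hopBound_lt
        obtain ⟨h, hh⟩ := ih (next u) (by rw [hnext]; omega) (nextNode_lt hω hk hrep hd hu)
        exact ⟨h + 1, hh⟩
  have harrive := hreach _ s le_rfl hs
  -- The first arrival time: all earlier nodes differ from `d`, so `hopBound` is strictly decreasing
  -- on them.
  set len := Nat.find harrive with hlen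
  have hlt : ∀ h, next^[h] s < ω.1 := by
    intro h
    induction h with
    | zero => exact hs
    | succ h ih =>
      rw [Function.iterate_succ_apply']
      exact nextNode_lt hω hk hrep hd ih
  have hne : ∀ h < len, next^[h] s ≠ d := fun h hh => Nat.find_min harrive hh
  have hhop : ∀ h < len, IsHop k ω d (next^[h] s) (next^[h + 1] s) := by
    intro h hh
    rw [Function.iterate_succ_apply']
    exact isHop_nextNode hω hk hrep hd (hlt h) (hne h hh)
  have hanti : ∀ h h', h < h' → h' < len →
      hopBound k ω d (next^[h'] s) < hopBound k ω d (next^[h] s) := by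
    intro h h' hh
    induction h', hh using Nat.le_induction with
    | base => exact fun hl => (hhop h (by omega)).hopBound_lt
    | succ h' _ ih => exact fun hl => ((hhop h' (by omega)).hopBound_lt).trans (ih (by omega))
  refine ⟨len, fun h => next^[h] s, rfl, Nat.find_spec harrive, hlt, fun h hh => (hhop h hh).1,
    fun h hh => (hhop h hh).2, fun h hh => (hhop h hh).3, ?_, ?_⟩
  · intro h
    induction h with
    | zero => exact Or.inl rfl
    | succ h ih =>
      by_cases hud : next^[h] s = d
      -- `d` is a fixed point of `next`, so the invariant persists beyond the end of the route.
      · right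
        rw [Function.iterate_succ_apply', hud]
        simp [hnext, nextNode]
      · have hp := (isHop_nextNode hω hk hrep hd (hlt h) hud).follows_path
        rw [Function.iterate_succ_apply']
        rcases hp with hp | hp
        · rwa [hnext, hp]
        · rw [hnext, hp]
          exact nextCell_snd_eq_or ih
  · intro c
    have hsub : ∀ h ∈ (Finset.range len).filter fun h => cell k (ω.2 (next^[h] s)) = c,
        hopBound k ω d (next^[h] s) ∈ Finset.Icc (2 * cellDist c (cell k (ω.2 d)))
          (2 * cellDist c (cell k (ω.2 d)) + 1) := by
      intro h hh
      simp only [Finset.mem_filter, Finset.mem_range] at hh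
      have := hopBound_div_two (k := k) (ω := ω) (hne h hh.1)
      rw [hh.2] at this
      rw [Finset.mem_Icc]
      omega
    have := Finset.card_le_card_of_injOn _ hsub ?_
    · rw [Nat.card_Icc] at this
      omega
    · intro h hh h' hh' heq
      simp only [Finset.coe_filter, Finset.mem_range, Set.mem_ofPred_eq] at hh hh'
      by_contra hcon
      rcases lt_or_gt_of_ne hcon with hl | hl
      · exact absurd heq (hanti h h' hl hh'.1).ne'
      · exact absurd heq (hanti h' h hl hh.1).ne

/-! ## The direct multihop operation -/

/-- If every fibre of `f` has at most `R` elements, then the elements can be numbered with `R`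
numbers such that the elements of a fibre get different numbers. -/
lemma exists_numbering {ι κ : Type*} [DecidableEq κ] (s : Finset ι) (f : ι → κ) (R : ℕ)
    (hR : ∀ c, (s.filter fun p => f p = c).card ≤ R) :
    ∃ g : ι → ℕ, (∀ p ∈ s, g p < R) ∧ ∀ p ∈ s, ∀ q ∈ s, f p = f q → g p = g q → p = q := by
  classical
  have hex : ∀ c, ∃ g : ι → ℕ, (∀ p ∈ s.filter fun p => f p = c, g p < R) ∧
      ∀ p ∈ s.filter fun p => f p = c, ∀ q ∈ s.filter fun p => f p = c, g p = g q → p = q := by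
    intro c
    refine ⟨fun p => if h : p ∈ s.filter fun p => f p = c then
      ((s.filter fun p => f p = c).equivFin ⟨p, h⟩ : ℕ) else 0, ?_, ?_⟩
    · intro p hp
      simp only [dif_pos hp]
      exact (Fin.is_lt _).trans_le (hR c)
    · intro p hp q hq hg
      simp only [dif_pos hp, dif_pos hq] at hg
      exact congrArg Subtype.val ((s.filter fun p => f p = c).equivFin.injective (Fin.ext hg))
  choose g hlt hinj using hex
  refine ⟨fun p => g (f p) p, fun p hp => hlt _ p (by simp [hp]), fun p hp q hq hf hg => ?_⟩
  simp only [hf] at hg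
  exact hinj (f q) p (by simp [hp, hf]) q (by simp [hq]) hg

lemma tdmaClass_mem (c : ℤ × ℤ) : 0 ≤ tdmaClass c ∧ tdmaClass c < 9 := by
  unfold tdmaClass; omega

/-- In a good placement, direct multihop routing is possible with frames of `9 * (4 * L)` slots. -/
lemma GoodPlacement.exists_strategy {P α : ℝ} (hP : 0 < P) (hα : 0 < α) {k L : ℕ} {ω : Config}
    (hω : GoodPlacement k L ω) (hk : 2 ≤ k) (hL : 0 < L) :
    ∃ σ : Strategy, IsDirectMultihop P α k ω σ ∧ σ.rounds = 4 * L ∧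
      ∀ p ∈ σ.hops ω, σ.tx ω p ≠ σ.rx ω p := by
  classical
  have hk0 : 0 < k := by omega
  have hlt : ∀ j < numPairs ω, 2 * j < ω.1 ∧ 2 * j + 1 < ω.1 := by
    unfold numPairs; intro j hj; omega
  have hex : ∀ j, ∃ len node, j < numPairs ω → IsRoute k ω (2 * j) (2 * j + 1) len node := by
    intro j
    by_cases hj : j < numPairs ω
    · obtain ⟨len, node, h⟩ := hω.exists_isRoute hk0 (hlt j hj).1 (hlt j hj).2
      exact ⟨len, node, fun _ => h⟩
    · exact ⟨0, fun _ => 0, fun h => absurd h hj⟩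
  choose len node hroute using hex
  -- The slots are placeholders: hops and loads do not depend on them, and the numbering of each
  -- cell's hops comes later.
  set σ₀ : Strategy := ⟨len, node, 4 * L, fun _ _ => 0⟩ with hσ₀
  have hgrid : ∀ p ∈ σ₀.hops ω, InGrid k (cell k (σ₀.tx ω p)) := by
    intro p hp
    obtain ⟨h1, -⟩ := Strategy.mem_hops.1 hp
    exact inGrid_cell hk0 (hω.mem_unitSquare _ ((hroute p.1 h1).node_lt p.2))
  have hload : ∀ c, ((σ₀.hops ω).filter fun p => cell k (σ₀.tx ω p) = c).card ≤ 4 * L := by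
    intro c
    set S := (σ₀.hops ω).filter fun p => cell k (σ₀.tx ω p) = c with hS
    rcases S.eq_empty_or_nonempty with hS0 | ⟨p₀, hp₀⟩
    · rw [hS0]; simp
    obtain ⟨⟨hc1, hc1'⟩, hc2, hc2'⟩ : InGrid k c := by
      obtain ⟨h1, h2⟩ := Finset.mem_filter.1 hp₀
      exact h2 ▸ hgrid p₀ h1
    have hfib : ∀ j ∈ S.image Prod.fst, (S.filter fun p => p.1 = j).card ≤ 2 := by
      intro j hj
      obtain ⟨p, hp, rfl⟩ := Finset.mem_image.1 hj
      have hp1 := (Strategy.mem_hops.1 (Finset.mem_filter.1 hp).1).1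
      refine le_trans (Finset.card_le_card_of_injOn Prod.snd ?_ ?_) ((hroute p.1 hp1).card_le c)
      · intro q hq
        simp only [hS, Finset.coe_filter, Finset.mem_filter, Set.mem_ofPred_eq,
          Strategy.mem_hops] at hq
        obtain ⟨⟨⟨-, hq2⟩, hq3⟩, hq4⟩ := hq
        simp only [Finset.coe_filter, Finset.mem_range, Set.mem_ofPred_eq]
        rw [← hq4]
        exact ⟨hq2, hq3⟩
      · intro q hq q' hq' h
        simp only [Finset.coe_filter, Set.mem_ofPred_eq] at hq hq'
        exact Prod.ext (hq.2.trans hq'.2.symm) h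
    have hcard := Finset.card_le_mul_card_image S 2 hfib
    have himg : S.image Prod.fst ⊆
        ((Finset.range (numPairs ω)).filter fun j => (cell k (ω.2 (2 * j))).2 = (c.2.toNat : ℤ)) ∪
        ((Finset.range (numPairs ω)).filter fun j =>
          (cell k (ω.2 (2 * j + 1))).1 = (c.1.toNat : ℤ)) := by
      intro j hj
      obtain ⟨p, hp, rfl⟩ := Finset.mem_image.1 hj
      obtain ⟨hp1, hp2⟩ := Finset.mem_filter.1 hp
      have hp1 := (Strategy.mem_hops.1 hp1).1
      have h := (hroute p.1 hp1).row_or_col p.2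
      change cell k (ω.2 (node p.1 p.2)) = c at hp2
      rw [hp2] at h
      simp only [Finset.mem_union, Finset.mem_filter, Finset.mem_range, Int.toNat_of_nonneg hc1,
        Int.toNat_of_nonneg hc2]
      rcases h with h | h
      · exact Or.inl ⟨hp1, h.symm⟩
      · exact Or.inr ⟨hp1, h.symm⟩
    have h1 := hω.card_row_le c.2.toNat (by omega)
    have h2 := hω.card_col_le c.1.toNat (by omega)
    have h3 := (Finset.card_le_card himg).trans (Finset.card_union_le _ _)
    omega
  obtain ⟨g, hgR, hg⟩ := exists_numbering (σ₀.hops ω) (fun p => cell k (σ₀.tx ω p)) (4 * L) hload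
  -- The residue modulo 9 is the class of the cell, the quotient the number of the hop among those
  -- of its cell.
  set σ : Strategy := ⟨len, node, 4 * L,
    fun j h => 9 * g (j, h) + (tdmaClass (cell k (σ₀.tx ω (j, h)))).toNat⟩ with hσ
  have hclass : ∀ c, ((tdmaClass c).toNat : ℤ) = tdmaClass c ∧ (tdmaClass c).toNat < 9 := by
    intro c
    have := tdmaClass_mem c
    omega
  have hmem : ∀ p ∈ σ.hops ω, p.1 < numPairs ω ∧ p.2 < len p.1 := fun p hp =>
    Strategy.mem_hops.1 hp
  have hlen : ∀ p ∈ σ.hops ω, HopLengthOK k (σ.tx ω p) (σ.rx ω p) := fun p hp =>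
    (hroute p.1 (hmem p hp).1).hop_length p.2 (hmem p hp).2
  refine ⟨σ, ⟨by simp only [hσ]; omega, ?_, ?_, ?_, ?_, hlen, ?_, ?_, ?_, ?_⟩, rfl, ?_⟩
  · exact fun j hj h _ => (hroute j hj).node_lt h
  · exact fun j hj => (hroute j hj).source
  · exact fun j hj => (hroute j hj).destination
  · exact fun p hp => (hroute p.1 (hmem p hp).1).follows_path p.2 (hmem p hp).2
  · intro p hp
    have h := hlen p hp
    have hk' : (2 : ℝ) ≤ k := by exact_mod_cast hk
    -- The power constraint needs hops of length at most `1`; this is where `2 ≤ k` enters.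
    have h1 : √2 / (k : ℝ) ≤ 1 := by
      rw [div_le_one (by positivity)]
      refine le_trans ?_ hk'
      rw [Real.sqrt_le_left (by norm_num)]
      norm_num
    unfold txPower
    have := Real.rpow_le_one dist_nonneg (h.trans h1) hα.le
    nlinarith
  · intro p hp
    have h1 := hgR p hp
    have h2 := (hclass (cell k (σ₀.tx ω p))).2
    change 9 * g p + (tdmaClass (cell k (σ₀.tx ω p))).toNat < 9 * (4 * L)
    omega
  · intro p hp
    have h2 := hclass (cell k (σ₀.tx ω p))
    change ((9 * g p + (tdmaClass (cell k (σ₀.tx ω p))).toNat : ℕ) : ℤ) % 9 =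
      tdmaClass (cell k (σ₀.tx ω p))
    omega
  · intro p hp q hq hslot hc
    have h2 := hclass (cell k (σ₀.tx ω p))
    refine hg p hp q hq hc ?_
    change 9 * g p + (tdmaClass (cell k (σ₀.tx ω p))).toNat =
      9 * g q + (tdmaClass (cell k (σ₀.tx ω q))).toNat at hslot
    change cell k (σ₀.tx ω p) = cell k (σ₀.tx ω q) at hc
    rw [hc] at hslot
    omega
  · exact fun p hp => (hroute p.1 (hmem p hp).1).ne p.2 (hmem p hp).2

/-! ## The uniform distribution -/

lemma measurable_apply (i : Fin 2) : Measurable fun x : Plane => x i :=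
  (PiLp.continuous_apply 2 (fun _ => ℝ) i).measurable

lemma measurableSet_box (a b : Fin 2 → ℝ) :
    MeasurableSet {x : Plane | ∀ i, x i ∈ Set.Ico (a i) (b i)} := by
  simp only [Set.ofPred_forall]
  exact MeasurableSet.iInter fun i =>
    measurable_apply i measurableSet_Ico

lemma volume_box (a b : Fin 2 → ℝ) :
    volume {x : Plane | ∀ i, x i ∈ Set.Ico (a i) (b i)} =
      ENNReal.ofReal (b 0 - a 0) * ENNReal.ofReal (b 1 - a 1) := by
  have h : {x : Plane | ∀ i, x i ∈ Set.Ico (a i) (b i)} =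
      (WithLp.ofLp : Plane → Fin 2 → ℝ) ⁻¹' (Set.univ.pi fun i => Set.Ico (a i) (b i)) := by
    ext x
    simp [Set.mem_pi]
  have hm : MeasurableSet (Set.univ.pi fun i : Fin 2 => Set.Ico (a i) (b i)) :=
    MeasurableSet.univ_pi fun _ => measurableSet_Ico
  rw [h, (PiLp.volume_preserving_ofLp (Fin 2)).measure_preimage hm.nullMeasurableSet,
    Real.volume_pi_Ico, Fin.prod_univ_two]

lemma measurableSet_unitSquare : MeasurableSet unitSquare :=
  measurableSet_box (fun _ => 0) (fun _ => 1)

lemma uniformSquare_box {a b : Fin 2 → ℝ} (ha : ∀ i, 0 ≤ a i) (hb : ∀ i, b i ≤ 1) :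
    uniformSquare {x : Plane | ∀ i, x i ∈ Set.Ico (a i) (b i)} =
      ENNReal.ofReal (b 0 - a 0) * ENNReal.ofReal (b 1 - a 1) := by
  rw [uniformSquare, Measure.restrict_apply (measurableSet_box a b), ← volume_box]
  congr 1
  rw [Set.inter_eq_left]
  intro x hx i
  exact ⟨(ha i).trans (hx i).1, (hx i).2.trans_le (hb i)⟩

lemma ae_mem_unitSquare : ∀ᵐ x ∂uniformSquare, x ∈ unitSquare :=
  ae_restrict_mem measurableSet_unitSquare

lemma uniformSquare_diagonal : (uniformSquare.prod uniformSquare) (Set.diagonal Plane) = 0 := by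
  rw [Measure.measure_prod_null measurableSet_diagonal]
  refine Filter.Eventually.of_forall fun x => ?_
  have : Prod.mk x ⁻¹' Set.diagonal Plane = {x} := by
    ext y; simp [eq_comm]
  have hna : NullSingletonClass uniformSquare := by unfold uniformSquare; infer_instance
  simp [this]

/-- One coordinate of a half cell: `v` is the displacement towards the neighbour, and `v = 0` leaves
the full interval. -/
lemma exists_half_interval (m v : ℤ) (hv : |v| ≤ 1) :
    ∃ a b : ℝ, (m : ℝ) ≤ a ∧ b ≤ m + 1 ∧ b - a = 1 - (|v| : ℤ) / 2 ∧
      ∀ y : ℝ, a ≤ y → y < b → ⌊y⌋ = m ∧ 0 ≤ (y - m - 1 / 2) * (v : ℝ) := by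
  rw [abs_le] at hv
  obtain rfl | rfl | rfl : v = 0 ∨ v = 1 ∨ v = -1 := by omega
  · refine ⟨m, m + 1, le_rfl, le_rfl, by simp, fun y h1 h2 => ⟨Int.floor_eq_iff.2 ⟨h1, h2⟩, by simp⟩⟩
  · refine ⟨m + 1 / 2, m + 1, by linarith, le_rfl, by norm_num, fun y h1 h2 =>
      ⟨Int.floor_eq_iff.2 ⟨by linarith, h2⟩, by push_cast; linarith⟩⟩
  · refine ⟨m, m + 1 / 2, by linarith, by linarith, by norm_num, fun y h1 h2 =>
      ⟨Int.floor_eq_iff.2 ⟨h1, by linarith⟩, by push_cast; linarith⟩⟩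

/-- A half cell contains a measurable set of probability at least `1 / (2 * k ^ 2)`. -/
lemma exists_measurableSet_toward {k : ℕ} (hk : 0 < k) {c c' : ℤ × ℤ} (hc : InGrid k c)
    (h : SameOrAdjacent c c') :
    ∃ B : Set Plane, MeasurableSet B ∧ ENNReal.ofReal (1 / (2 * (k : ℝ) ^ 2)) ≤ uniformSquare B ∧
      ∀ x ∈ B, Toward k c c' x := by
  have hk' : (0 : ℝ) < k := by exact_mod_cast hk
  obtain ⟨⟨h1, h2⟩, h3, h4⟩ := hc
  unfold SameOrAdjacent at h
  rw [abs_sub_comm c.1, abs_sub_comm c.2] at h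
  have p0 := abs_nonneg (c'.1 - c.1)
  have p1 := abs_nonneg (c'.2 - c.2)
  obtain ⟨a0, b0, ha0, hb0, hab0, hy0⟩ := exists_half_interval c.1 (c'.1 - c.1) (by omega)
  obtain ⟨a1, b1, ha1, hb1, hab1, hy1⟩ := exists_half_interval c.2 (c'.2 - c.2) (by omega)
  have g1 : (0 : ℝ) ≤ c.1 := by exact_mod_cast h1
  have g2 : (c.1 : ℝ) + 1 ≤ k := by exact_mod_cast h2
  have g3 : (0 : ℝ) ≤ c.2 := by exact_mod_cast h3
  have g4 : (c.2 : ℝ) + 1 ≤ k := by exact_mod_cast h4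
  refine ⟨{x : Plane | ∀ i, x i ∈ Set.Ico ((![a0 / k, a1 / k] : Fin 2 → ℝ) i)
    ((![b0 / k, b1 / k] : Fin 2 → ℝ) i)}, measurableSet_box _ _, ?_, ?_⟩
  · rw [uniformSquare_box]
    · simp only [Matrix.cons_val_zero, Matrix.cons_val_one]
      set v0 := |c'.1 - c.1|
      set v1 := |c'.2 - c.2|
      have q0 : (0 : ℝ) ≤ v0 := by exact_mod_cast p0
      have q1 : (0 : ℝ) ≤ v1 := by exact_mod_cast p1
      have q : (v0 : ℝ) + v1 ≤ 1 := by exact_mod_cast h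
      rw [← sub_div, ← sub_div, hab0, hab1, ← ENNReal.ofReal_mul (by
        have : (0 : ℝ) ≤ 1 - v0 / 2 := by linarith
        positivity)]
      -- The displacements satisfy `v0 + v1 ≤ 1`, hence `(1 - v0 / 2) * (1 - v1 / 2) ≥ 1 / 2`.
      refine ENNReal.ofReal_le_ofReal ?_
      rw [div_mul_div_comm, div_le_div_iff₀ (by positivity) (by positivity)]
      nlinarith [mul_nonneg q0 q1, mul_pos hk' hk', mul_nonneg (mul_pos hk' hk').le
        (mul_nonneg q0 q1), mul_nonneg (mul_pos hk' hk').le (sub_nonneg.2 q)]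
    · intro i
      fin_cases i
      · exact div_nonneg (g1.trans ha0) hk'.le
      · exact div_nonneg (g3.trans ha1) hk'.le
    · intro i
      fin_cases i
      · exact (div_le_one hk').2 (hb0.trans g2)
      · exact (div_le_one hk').2 (hb1.trans g4)
  · intro x hx
    have e0 := hx 0
    have e1 := hx 1
    simp only [Matrix.cons_val_zero, Matrix.cons_val_one, Set.mem_Ico] at e0 e1
    rw [div_le_iff₀' hk', lt_div_iff₀' hk'] at e0 e1
    obtain ⟨f0, f0'⟩ := hy0 _ e0.1 e0.2
    obtain ⟨f1, f1'⟩ := hy1 _ e1.1 e1.2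
    exact ⟨Prod.ext f0 f1, f0', f1'⟩

/-- The points in a given row (or column) of cells. -/
def strip (k : ℕ) (i : Fin 2) (r : ℤ) : Set Plane := {x | ⌊(k : ℝ) * x i⌋ = r}

lemma measurableSet_strip (k : ℕ) (i : Fin 2) (r : ℤ) : MeasurableSet (strip k i r) :=
  ((measurable_apply i).const_mul (k : ℝ)).floor (measurableSet_singleton r)

lemma uniformSquare_strip_le {k : ℕ} (hk : 0 < k) (i : Fin 2) (r : ℤ) :
    uniformSquare (strip k i r) ≤ ENNReal.ofReal (1 / k) := by
  have hk' : (0 : ℝ) < k := by exact_mod_cast hk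
  rw [uniformSquare, Measure.restrict_apply (measurableSet_strip k i r)]
  have hsub : strip k i r ∩ unitSquare ⊆ {x : Plane | ∀ l, x l ∈
      Set.Ico (if l = i then (r : ℝ) / k else 0) (if l = i then ((r : ℝ) + 1) / k else 1)} := by
    rintro x ⟨hx, hx'⟩ l
    split_ifs with hl
    · subst hl
      obtain ⟨h1, h2⟩ := Int.floor_eq_iff.1 (show ⌊(k : ℝ) * x l⌋ = r from hx)
      rw [Set.mem_Ico, div_le_iff₀' hk', lt_div_iff₀' hk']
      exact ⟨h1, h2⟩
    · exact hx' l
  refine (measure_mono hsub).trans ?_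
  rw [volume_box]
  have e : ((r : ℝ) + 1) / k - r / k = 1 / k := by ring
  fin_cases i <;> simp [e]

/-! ## Node counts -/

open ProbabilityTheory in
open Classical in
/-- Chebyshev's inequality for the number of those among `J` nodes that lie in the set `S`. -/
lemma measure_count_ge_le {S : Set Plane} (hS : MeasurableSet S) {e : ℕ → ℕ}
    (he : Function.Injective e) (J : ℕ) {q t : ℝ} (ht : 0 < t) (hq : 0 ≤ q)
    (hqS : uniformSquare S ≤ ENNReal.ofReal q) :
    (Measure.infinitePi fun _ : ℕ => uniformSquare)
      {x | J * q + t ≤ (((Finset.range J).filter fun j => x (e j) ∈ S).card : ℝ)} ≤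
      ENNReal.ofReal (J * q / t ^ 2) := by
  classical
  set μ := Measure.infinitePi fun _ : ℕ => uniformSquare with hμ
  set Y : ℕ → (ℕ → Plane) → ℝ := fun j x => S.indicator (fun _ => (1 : ℝ)) (x (e j)) with hY
  have hind : Measurable (S.indicator fun _ => (1 : ℝ)) := measurable_const.indicator hS
  have hYm : ∀ j, Measurable (Y j) := fun j => hind.comp (measurable_pi_apply (e j))
  have hbd : ∀ j x, ‖Y j x‖ ≤ 1 := by
    intro j x
    simp only [hY, Set.indicator]
    split_ifs <;> simp
  have hL2 : ∀ j, MemLp (Y j) 2 μ := fun j =>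
    MemLp.of_bound (hYm j).aestronglyMeasurable 1 (Filter.Eventually.of_forall (hbd j))
  have hint : ∀ j, ∫ x, Y j x ∂μ = uniformSquare.real S := by
    intro j
    have h := (measurePreserving_eval_infinitePi (fun _ : ℕ => uniformSquare) (e j))
    have h2 := integral_map (μ := μ) h.measurable.aemeasurable
      (f := S.indicator fun _ => (1 : ℝ)) hind.aestronglyMeasurable
    rw [hμ, h.map_eq] at h2
    change ∫ x : ℕ → Plane, S.indicator (fun _ => (1 : ℝ)) (x (e j)) ∂_ = _
    rw [← h2, integral_indicator hS]
    simp
  have hreal : uniformSquare.real S ≤ q := by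
    rw [measureReal_def]
    exact ENNReal.toReal_le_of_le_ofReal hq hqS
  have hvar : ∀ j, variance (Y j) μ ≤ q := by
    intro j
    refine (variance_le_expectation_sq (hYm j).aestronglyMeasurable).trans ?_
    have : Y j ^ 2 = Y j := by
      ext x
      simp only [Pi.pow_apply, hY, Set.indicator]
      split_ifs <;> simp
    rw [this, hint]
    exact hreal
  have hindep : iIndepFun (fun (i : ℕ) (x : ℕ → Plane) => S.indicator (fun _ => (1 : ℝ)) (x i)) μ :=
    iIndepFun_infinitePi (X := fun _ => S.indicator fun _ => (1 : ℝ)) fun _ => hind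
  have hsumvar : variance (∑ j ∈ Finset.range J, Y j) μ ≤ J * q := by
    rw [IndepFun.variance_sum (fun j _ => hL2 j)
      (fun i _ j _ hij => hindep.indepFun fun h => hij (he h))]
    calc _ ≤ ∑ j ∈ Finset.range J, q := Finset.sum_le_sum fun j _ => hvar j
      _ = J * q := by simp
  have hmean : ∫ x, (∑ j ∈ Finset.range J, Y j) x ∂μ ≤ J * q := by
    simp only [Finset.sum_apply]
    rw [integral_finsetSum _ fun j _ => (hL2 j).integrable (by norm_num)]
    simp only [hint, Finset.sum_const, Finset.card_range, nsmul_eq_mul]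
    gcongr
  have hcheb := meas_ge_le_variance_div_sq (μ := μ)
    (memLp_finsetSum' (Finset.range J) fun j _ => hL2 j) ht
  refine le_trans (measure_mono ?_) (hcheb.trans (ENNReal.ofReal_le_ofReal (by gcongr)))
  intro x hx
  have hx : J * q + t ≤ (((Finset.range J).filter fun j => x (e j) ∈ S).card : ℝ) := hx
  have hcount : (∑ j ∈ Finset.range J, Y j) x =
      (((Finset.range J).filter fun j => x (e j) ∈ S).card : ℝ) := by
    simp [hY, Finset.sum_apply, Set.indicator]
  change t ≤ |(∑ j ∈ Finset.range J, Y j) x - ∫ x, (∑ j ∈ Finset.range J, Y j) x ∂μ|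
  rw [hcount]
  refine le_trans ?_ (le_abs_self _)
  linarith

/-! ## The Poisson distribution -/

open ProbabilityTheory in
-- The generating function of the Poisson law, used at `z = ρ` for the tails and at `z = 1 - q` for
-- void probabilities.
lemma tsum_poissonMeasure_mul_pow (r : NNReal) {z : ℝ} (hz : 0 ≤ z) :
    ∑' N : ℕ, poissonMeasure r {N} * ENNReal.ofReal (z ^ N) =
      ENNReal.ofReal (Real.exp (r * (z - 1))) := by
  have hs : HasSum (fun N : ℕ => Real.exp (-r) * (r : ℝ) ^ N / N.factorial * z ^ N)
      (Real.exp (r * (z - 1))) := by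
    have h := (NormedSpace.expSeries_div_hasSum_exp ((r : ℝ) * z)).mul_left (Real.exp (-r))
    rw [← Real.exp_eq_exp_ℝ, ← Real.exp_add] at h
    convert! h using 1
    · ext N
      rw [mul_pow]
      ring
    · congr 1
      ring
  rw [← hs.tsum_eq, ENNReal.ofReal_tsum_of_nonneg (fun N => by positivity) hs.summable]
  refine tsum_congr fun N => ?_
  rw [poissonMeasure_singleton, ← ENNReal.ofReal_mul (by positivity)]

open ProbabilityTheory in
/-- Chernoff's bound for both tails of the Poisson distribution. -/
lemma poissonMeasure_chernoff (r : NNReal) {ρ : ℝ} (hρ : 0 < ρ) :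
    poissonMeasure r {N | ρ ^ (ρ * r) ≤ ρ ^ (N : ℝ)} ≤
      ENNReal.ofReal (Real.exp (r * (ρ - 1 - ρ * Real.log ρ))) := by
  -- Markov's inequality for `ρ ^ N`. The event means `N ≥ ρ * r` if `ρ > 1` and `N ≤ ρ * r` if `ρ <
  -- 1`, so both tails are covered.
  have h := mul_meas_ge_le_lintegral (μ := poissonMeasure r)
    (f := fun N : ℕ => ENNReal.ofReal (ρ ^ N)) (by fun_prop) (ENNReal.ofReal (ρ ^ (ρ * r)))
  have h2 : ∫⁻ N : ℕ, ENNReal.ofReal (ρ ^ N) ∂poissonMeasure r =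
      ENNReal.ofReal (Real.exp (r * (ρ - 1))) := by
    rw [lintegral_countable', ← tsum_poissonMeasure_mul_pow r hρ.le]
    exact tsum_congr fun N => mul_comm _ _
  rw [h2] at h
  have hpos : 0 < ρ ^ (ρ * r) := by positivity
  have e : Real.exp (r * (ρ - 1 - ρ * Real.log ρ)) = Real.exp (r * (ρ - 1)) / ρ ^ (ρ * r) := by
    rw [Real.rpow_def_of_pos hρ, ← Real.exp_sub]
    congr 1
    ring
  rw [e, ENNReal.ofReal_div_of_pos hpos, ENNReal.le_div_iff_mul_le
    (Or.inl (by simpa using hpos)) (Or.inl ENNReal.ofReal_ne_top), mul_comm]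
  refine le_trans (mul_le_mul_right (measure_mono ?_) _) h
  intro N hN
  exact ENNReal.ofReal_le_ofReal (by simpa using hN)

lemma sub_one_sub_mul_log_neg {ρ : ℝ} (hρ : 0 < ρ) (h1 : ρ ≠ 1) : ρ - 1 - ρ * Real.log ρ < 0 := by
  have h := Real.log_lt_sub_one_of_pos (inv_pos.2 hρ) (by simpa using h1)
  rw [Real.log_inv] at h
  have : ρ * (-Real.log ρ) < ρ * (ρ⁻¹ - 1) := mul_lt_mul_of_pos_left h hρ
  rw [mul_sub, mul_inv_cancel₀ hρ.ne'] at this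
  linarith

instance (n : ℝ) : IsProbabilityMeasure (poissonNetwork n) := by
  unfold poissonNetwork; infer_instance

lemma poissonNetwork_fst {n : ℝ} (S : Set ℕ) :
    poissonNetwork n {ω | ω.1 ∈ S} = ProbabilityTheory.poissonMeasure n.toNNReal S := by
  have : {ω : Config | ω.1 ∈ S} = S ×ˢ Set.univ := by ext; simp
  rw [this, poissonNetwork, Measure.prod_prod]
  simp

lemma poissonNetwork_snd {n : ℝ} (S : Set (ℕ → Plane)) :
    poissonNetwork n {ω | ω.2 ∈ S} = (Measure.infinitePi fun _ : ℕ => uniformSquare) S := by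
  have : {ω : Config | ω.2 ∈ S} = Set.univ ×ˢ S := by ext; simp
  rw [this, poissonNetwork, Measure.prod_prod]
  simp

lemma tendsto_poissonNetwork_of_chernoff {ρ : ℝ} (hρ : 0 < ρ) (h1 : ρ ≠ 1) :
    Tendsto (fun n : ℝ => poissonNetwork n {ω | ρ ^ (ρ * n) ≤ ρ ^ (ω.1 : ℝ)}) atTop (𝓝 0) := by
  have hc := sub_one_sub_mul_log_neg hρ h1
  have hlim : Tendsto (fun n : ℝ => ENNReal.ofReal (Real.exp (n * (ρ - 1 - ρ * Real.log ρ)))) atTop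
      (𝓝 0) := by
    rw [← ENNReal.ofReal_zero]
    refine ENNReal.tendsto_ofReal (Real.tendsto_exp_atBot.comp ?_)
    exact tendsto_id.atTop_mul_const_of_neg hc
  refine tendsto_of_tendsto_of_tendsto_of_le_of_le' tendsto_const_nhds hlim
    (Filter.Eventually.of_forall fun _ => zero_le) ?_
  filter_upwards [eventually_ge_atTop 0] with n hn
  have h := poissonMeasure_chernoff n.toNNReal hρ
  rw [Real.coe_toNNReal n hn] at h
  refine le_trans (le_of_eq ?_) h
  exact poissonNetwork_fst {N : ℕ | ρ ^ (ρ * n) ≤ ρ ^ (N : ℝ)}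

/-- The number of nodes is w.h.p. at most `ρ * n`, for `ρ > 1`. -/
lemma tendsto_poissonNetwork_gt {ρ : ℝ} (hρ : 1 < ρ) :
    Tendsto (fun n : ℝ => poissonNetwork n {ω | ρ * n < (ω.1 : ℝ)}) atTop (𝓝 0) :=
  tendsto_of_tendsto_of_tendsto_of_le_of_le tendsto_const_nhds
    (tendsto_poissonNetwork_of_chernoff (by linarith) hρ.ne') (fun _ => zero_le)
    fun _ => measure_mono fun _ h => Real.rpow_le_rpow_of_exponent_le hρ.le (le_of_lt h)

/-- The number of nodes is w.h.p. at least `ρ * n`, for `ρ < 1`. -/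
lemma tendsto_poissonNetwork_lt {ρ : ℝ} (h0 : 0 < ρ) (hρ : ρ < 1) :
    Tendsto (fun n : ℝ => poissonNetwork n {ω | (ω.1 : ℝ) < ρ * n}) atTop (𝓝 0) :=
  tendsto_of_tendsto_of_tendsto_of_le_of_le tendsto_const_nhds
    (tendsto_poissonNetwork_of_chernoff h0 hρ.ne) (fun _ => zero_le)
    fun _ => measure_mono fun _ h => Real.rpow_le_rpow_of_exponent_ge h0 hρ.le (le_of_lt h)

/-- The void probability of a Poisson point process. -/
lemma poissonNetwork_void_le {n q : ℝ} (hn : 0 ≤ n) (hq1 : q ≤ 1) {B : Set Plane}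
    (hB : MeasurableSet B) (hqB : ENNReal.ofReal q ≤ uniformSquare B) :
    poissonNetwork n {ω | ∀ i < ω.1, ω.2 i ∉ B} ≤ ENNReal.ofReal (Real.exp (-(n * q))) := by
  -- Split by the number `N` of nodes: `N` independent points miss `B` with probability at most `(1
  -- - q) ^ N`.
  have hsub : {ω : Config | ∀ i < ω.1, ω.2 i ∉ B} ⊆
      ⋃ N : ℕ, ({N} : Set ℕ) ×ˢ (Set.pi (Finset.range N : Set ℕ) fun _ => Bᶜ) := by
    intro ω hω
    simp only [Set.mem_iUnion, Set.mem_prod, Set.mem_singleton_iff]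
    exact ⟨ω.1, rfl, fun i hi => hω i (by simpa using hi)⟩
  have hcompl : uniformSquare Bᶜ ≤ ENNReal.ofReal (1 - q) := by
    rw [prob_compl_eq_one_sub hB]
    rcases le_or_gt 0 q with h0 | h0
    · rw [ENNReal.ofReal_sub _ h0, ENNReal.ofReal_one]
      exact tsub_le_tsub_left hqB 1
    · exact tsub_le_self.trans (by rw [← ENNReal.ofReal_one]
                                   exact ENNReal.ofReal_le_ofReal (by linarith))
  refine (measure_mono hsub).trans ((measure_iUnion_le _).trans ?_)
  calc ∑' N : ℕ, poissonNetwork n (({N} : Set ℕ) ×ˢ (Set.pi (Finset.range N : Set ℕ) fun _ => Bᶜ))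
      ≤ ∑' N : ℕ, ProbabilityTheory.poissonMeasure n.toNNReal {N} *
          ENNReal.ofReal ((1 - q) ^ N) := by
        refine ENNReal.tsum_le_tsum fun N => ?_
        rw [poissonNetwork, Measure.prod_prod, Measure.infinitePi_pi _ fun _ _ => hB.compl]
        gcongr
        rw [Finset.prod_const, Finset.card_range, ENNReal.ofReal_pow (by linarith)]
        gcongr
    _ = _ := by
        rw [tsum_poissonMeasure_mul_pow _ (by linarith), Real.coe_toNNReal n hn]
        congr 2
        ring

/-! ## Good placements are likely -/

lemma sqrt_cellArea {n : ℝ} (hn : 0 < n) :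
    √(cellArea n) = √2 * √(n * Real.log n) / n := by
  have : cellArea n = 2 * (n * Real.log n) / n ^ 2 := by unfold cellArea; field_simp
  rw [this, Real.sqrt_div' _ (by positivity), Real.sqrt_mul (by norm_num), Real.sqrt_sq hn.le]

/-- The sizes for which the placement of a network of density `n` is shown to be good. -/
structure LargeDensity (n : ℝ) : Prop where
  one_lt : 1 < n
  one_lt_log : 1 < Real.log n
  two_le : 2 ≤ cellsPerSide (cellArea n)
  cells_mul_le : cellsPerSide (cellArea n) * (√2 * √(n * Real.log n)) ≤ n
  ceil_le : (⌈5 / 8 * n⌉₊ : ℝ) ≤ n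
  mean_add_le : ⌈5 / 8 * n⌉₊ * (1 / (cellsPerSide (cellArea n) : ℝ)) + √(n * Real.log n) / 4 ≤
    √2 * √(n * Real.log n)

/-- With `s = √(n * log n)`, the cell side is at most `1 / 10`, so rounding `k` down costs at most a
tenth and `n / k ≤ 10 / 9 * √2 * s`. For `n > 40` the ceiling is at most `13 / 20 * n`, so the mean
is at most `13 / 18 * √2 * s`; the remaining `5 / 18 * √2 * s` exceeds `s / 4`. -/
lemma eventually_largeDensity : ∀ᶠ n : ℝ in atTop, LargeDensity n := by
  have hlim : Tendsto (fun n : ℝ => Real.log n / n) atTop (𝓝 0) :=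
    Real.isLittleO_log_id_atTop.tendsto_div_nhds_zero
  filter_upwards [eventually_gt_atTop 40, Real.tendsto_log_atTop.eventually_gt_atTop 1,
    hlim.eventually_lt_const (show (0 : ℝ) < 1 / 200 by norm_num)] with n hn hlog hsmall
  have hn0 : 0 < n := by linarith
  have hlog0 : 0 < Real.log n := by linarith
  set s := √(n * Real.log n) with hs
  have hs0 : 0 < s := by positivity
  have h2 : (1 : ℝ) ≤ √2 := Real.one_le_sqrt.2 (by norm_num)
  have hq : √(cellArea n) = √2 * s / n := sqrt_cellArea hn0
  have hq0 : 0 < √2 * s / n := by positivity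
  have hq1 : √2 * s / n ≤ 1 / 10 := by
    rw [← hq, Real.sqrt_le_left (by norm_num)]
    unfold cellArea
    rw [mul_div_assoc]
    linarith
  set k := cellsPerSide (cellArea n) with hk
  have hk1 : (k : ℝ) ≤ 1 / (√2 * s / n) := by
    rw [hk, cellsPerSide, hq]
    exact Nat.floor_le (by positivity)
  have hk2 : 1 / (√2 * s / n) < (k : ℝ) + 1 := by
    rw [hk, cellsPerSide, hq]
    exact Nat.lt_floor_add_one _
  have h10 : (10 : ℝ) ≤ 1 / (√2 * s / n) := by
    rw [le_div_iff₀ hq0]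
    linarith
  have hk9 : (9 : ℝ) < k := by linarith
  have hkm : k * (√2 * s) ≤ n := by
    rw [le_div_iff₀ hq0, mul_div_assoc', div_le_iff₀ hn0] at hk1
    linarith
  have hkm' : 9 / 10 * n ≤ k * (√2 * s) := by
    have h : 9 / 10 * (1 / (√2 * s / n)) ≤ k := by linarith
    rw [mul_one_div, div_le_iff₀ hq0, mul_div_assoc', le_div_iff₀ hn0] at h
    linarith
  have hJ : (⌈5 / 8 * n⌉₊ : ℝ) ≤ 13 / 20 * n := by
    have := Nat.ceil_lt_add_one (show 0 ≤ 5 / 8 * n by positivity)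
    linarith
  refine ⟨by linarith, hlog, ?_, hkm, by linarith, ?_⟩
  · have : (2 : ℝ) ≤ k := by linarith
    exact_mod_cast this
  · have h1 : ⌈5 / 8 * n⌉₊ * (1 / (k : ℝ)) ≤ 13 / 18 * (√2 * s) := by
      rw [mul_one_div, div_le_iff₀ (by linarith)]
      nlinarith
    nlinarith

/-- The number of pairs whose traffic may pass through a given row or column of cells. -/
noncomputable def loadBound (n : ℝ) : ℕ := ⌊√2 * √(n * Real.log n)⌋₊

lemma ae_nodes_mem_unitSquare (n : ℝ) :
    poissonNetwork n {ω | ¬ ∀ i, ω.2 i ∈ unitSquare} = 0 := by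
  rw [show {ω : Config | ¬ ∀ i, ω.2 i ∈ unitSquare} =
    {ω | ω.2 ∈ {x : ℕ → Plane | ¬ ∀ i, x i ∈ unitSquare}} from rfl, poissonNetwork_snd]
  refine ae_iff.1 (ae_all_iff.2 fun i => ?_)
  exact (measurePreserving_eval_infinitePi (fun _ : ℕ => uniformSquare)
    i).quasiMeasurePreserving.ae ae_mem_unitSquare

lemma ae_nodes_injective (n : ℝ) :
    poissonNetwork n {ω | ¬ ∀ i j, i ≠ j → ω.2 i ≠ ω.2 j} = 0 := by
  rw [show {ω : Config | ¬ ∀ i j, i ≠ j → ω.2 i ≠ ω.2 j} =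
    {ω | ω.2 ∈ {x : ℕ → Plane | ¬ ∀ i j, i ≠ j → x i ≠ x j}} from rfl, poissonNetwork_snd]
  refine ae_iff.1 (ae_all_iff.2 fun i => ae_all_iff.2 fun j => ?_)
  by_cases hij : i = j
  · simp [hij]
  · have h := uniformSquare_diagonal
    rw [← Measure.infinitePi_map_eval_prod (P := fun _ : ℕ => uniformSquare) hij,
      Measure.map_apply (by fun_prop) measurableSet_diagonal] at h
    rw [ae_iff]
    refine measure_mono_null ?_ h
    intro x hx
    have hx : ¬ (i ≠ j → x i ≠ x j) := hx
    simpa [hij] using hx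

/-- The probability that some half cell is empty. -/
lemma measure_exists_empty_half_le {n : ℝ} (hn : LargeDensity n) :
    poissonNetwork n {ω | ∃ c c', InGrid (cellsPerSide (cellArea n)) c ∧ SameOrAdjacent c c' ∧
      c' ≠ c ∧ ∀ i < ω.1, ¬ Toward (cellsPerSide (cellArea n)) c c' (ω.2 i)} ≤
      ENNReal.ofReal (2 / Real.log n) := by
  obtain ⟨hn1, hlog, hk2, hkm, -, -⟩ := hn
  set k := cellsPerSide (cellArea n)
  have hn0 : 0 < n := by linarith
  have hk0 : 0 < k := by omega
  have hk' : (2 : ℝ) ≤ k := by exact_mod_cast hk2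
  have hkk : (k : ℝ) ^ 2 * (2 * Real.log n) ≤ n := by
    have h := pow_le_pow_left₀ (by positivity) hkm 2
    rw [mul_pow, mul_pow, Real.sq_sqrt (by norm_num), Real.sq_sqrt (by positivity)] at h
    refine le_of_mul_le_mul_right ?_ hn0
    nlinarith
  set D : Finset (ℤ × ℤ) := {(1, 0), (-1, 0), (0, 1), (0, -1)} with hD
  have hsub : {ω : Config | ∃ c c', InGrid k c ∧ SameOrAdjacent c c' ∧ c' ≠ c ∧
      ∀ i < ω.1, ¬ Toward k c c' (ω.2 i)} ⊆
      ⋃ q ∈ (Finset.range k ×ˢ Finset.range k) ×ˢ D, {ω : Config | ∀ i < ω.1,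
        ¬ Toward k (q.1.1, q.1.2) ((q.1.1 : ℤ) + q.2.1, (q.1.2 : ℤ) + q.2.2) (ω.2 i)} := by
    rintro ω ⟨c, c', ⟨⟨h1, h2⟩, h3, h4⟩, hadj, hne, hω⟩
    simp only [Set.mem_iUnion]
    refine ⟨((c.1.toNat, c.2.toNat), (c'.1 - c.1, c'.2 - c.2)), ?_, ?_⟩
    · have hne' : ¬ (c'.1 = c.1 ∧ c'.2 = c.2) := fun h => hne (Prod.ext h.1 h.2)
      simp only [Finset.mem_product, Finset.mem_range, hD, Finset.mem_insert,
        Finset.mem_singleton, Prod.mk.injEq]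
      unfold SameOrAdjacent at hadj
      refine ⟨by omega, ?_⟩
      rcases abs_cases (c.1 - c'.1) with h | h <;> rcases abs_cases (c.2 - c'.2) with h' | h' <;>
        omega
    · simpa [h1, h3] using hω
  have hone : ∀ q ∈ (Finset.range k ×ˢ Finset.range k) ×ˢ D, poissonNetwork n {ω : Config |
      ∀ i < ω.1, ¬ Toward k (q.1.1, q.1.2) ((q.1.1 : ℤ) + q.2.1, (q.1.2 : ℤ) + q.2.2) (ω.2 i)} ≤
      ENNReal.ofReal (1 / n) := by
    rintro ⟨⟨c1, c2⟩, v⟩ hq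
    simp only [Finset.mem_product, Finset.mem_range, hD, Finset.mem_insert,
        Finset.mem_singleton] at hq
    obtain ⟨⟨hc1, hc2⟩, hv⟩ := hq
    obtain ⟨B, hB, hBm, hBt⟩ := exists_measurableSet_toward hk0 (c := ((c1 : ℤ), (c2 : ℤ)))
      (c' := ((c1 : ℤ) + v.1, (c2 : ℤ) + v.2)) (by simp only [InGrid]; omega) (by
        unfold SameOrAdjacent
        rcases hv with rfl | rfl | rfl | rfl <;> simp)
    have h := poissonNetwork_void_le hn0.le (q := 1 / (2 * (k : ℝ) ^ 2)) (by
      rw [div_le_one (by positivity)]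
      nlinarith) hB hBm
    refine (measure_mono ?_).trans (h.trans (ENNReal.ofReal_le_ofReal ?_))
    · exact fun ω hω i hi hiB => hω i hi (hBt _ hiB)
    · have : Real.log n ≤ n * (1 / (2 * (k : ℝ) ^ 2)) := by
        rw [mul_one_div, le_div_iff₀ (by positivity)]
        linarith
      calc Real.exp (-(n * (1 / (2 * (k : ℝ) ^ 2)))) ≤ Real.exp (-Real.log n) := by gcongr
        _ = 1 / n := by rw [Real.exp_neg, Real.exp_log hn0, one_div]
  refine (measure_mono hsub).trans ((measure_biUnion_finset_le _ _).trans
    ((Finset.sum_le_sum hone).trans ?_))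
  rw [Finset.sum_const, nsmul_eq_mul, ← ENNReal.ofReal_natCast, ← ENNReal.ofReal_mul (by positivity)]
  refine ENNReal.ofReal_le_ofReal ?_
  -- Four halves for each of the `k ^ 2` cells, each empty with probability at most `1 / n`, and `k
  -- ^ 2 ≤ n / (2 * log n)`.
  have hcard : ((Finset.range k ×ˢ Finset.range k) ×ˢ D).card = k ^ 2 * 4 := by
    rw [Finset.card_product, Finset.card_product, Finset.card_range, sq]
    rfl
  rw [hcard, mul_one_div, div_le_div_iff₀ hn0 (by linarith)]
  push_cast
  linarith

/-- The probability that some row or column of cells contains the sources or destinations of too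
many pairs. -/
lemma measure_exists_crowded_strip_le {n : ℝ} (hn : LargeDensity n) (l : Fin 2) {e : ℕ → ℕ}
    (he : Function.Injective e) :
    poissonNetwork n {ω | (ω.1 : ℝ) ≤ 5 / 4 * n ∧ ∃ r < cellsPerSide (cellArea n), loadBound n <
      ((Finset.range (numPairs ω)).filter fun j =>
        ⌊(cellsPerSide (cellArea n) : ℝ) * ω.2 (e j) l⌋ = r).card} ≤
      ENNReal.ofReal (16 / Real.log n) := by
  classical
  obtain ⟨hn1, hlog, hk2, -, hJn, hmean⟩ := hn
  set k := cellsPerSide (cellArea n)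
  have hn0 : 0 < n := by linarith
  have hk0 : 0 < k := by omega
  have hk' : (2 : ℝ) ≤ k := by exact_mod_cast hk2
  set J := ⌈5 / 8 * n⌉₊ with hJ
  set s := √(n * Real.log n) with hs
  have hs0 : 0 < s := by positivity
  have hs2 : s ^ 2 = n * Real.log n := Real.sq_sqrt (by positivity)
  -- The random number of pairs is replaced by the deterministic bound `J`, so that Chebyshev's
  -- inequality applies to a fixed number of independent nodes.
  have hsub : {ω : Config | (ω.1 : ℝ) ≤ 5 / 4 * n ∧ ∃ r < k, loadBound n <
      ((Finset.range (numPairs ω)).filter fun j => ⌊(k : ℝ) * ω.2 (e j) l⌋ = r).card} ⊆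
      ⋃ r ∈ Finset.range k, {ω : Config | ω.2 ∈ {x : ℕ → Plane | J * (1 / (k : ℝ)) + s / 4 ≤
        (((Finset.range J).filter fun j => x (e j) ∈ strip k l r).card : ℝ)}} := by
    rintro ω ⟨hω, r, hr, hcount⟩
    simp only [Set.mem_iUnion]
    refine ⟨r, Finset.mem_range.2 hr, ?_⟩
    have hpairs : numPairs ω ≤ J := by
      have h1 : 2 * numPairs ω ≤ ω.1 := by unfold numPairs; omega
      have h2 : 2 * (numPairs ω : ℝ) ≤ ω.1 := by exact_mod_cast h1
      have h3 := Nat.le_ceil (5 / 8 * n)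
      rw [← hJ] at h3
      have h4 : (numPairs ω : ℝ) ≤ J := by linarith
      exact_mod_cast h4
    have hle : ((Finset.range (numPairs ω)).filter fun j => ⌊(k : ℝ) * ω.2 (e j) l⌋ = r).card ≤
        ((Finset.range J).filter fun j => ω.2 (e j) ∈ strip k l r).card := by
      refine Finset.card_le_card fun j hj => ?_
      simp only [Finset.mem_filter, Finset.mem_range] at hj ⊢
      exact ⟨hj.1.trans_le hpairs, hj.2⟩
    have h1 : (loadBound n : ℝ) + 1 ≤
        ((Finset.range J).filter fun j => ω.2 (e j) ∈ strip k l r).card := by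
      exact_mod_cast Nat.succ_le_of_lt (hcount.trans_le hle)
    have h2 : √2 * s < (loadBound n : ℝ) + 1 := Nat.lt_floor_add_one _
    exact hmean.trans (h2.le.trans h1)
  refine (measure_mono hsub).trans ((measure_biUnion_finset_le _ _).trans ?_)
  calc _ ≤ ∑ r ∈ Finset.range k, ENNReal.ofReal (J * (1 / (k : ℝ)) / (s / 4) ^ 2) := by
        refine Finset.sum_le_sum fun r _ => ?_
        rw [poissonNetwork_snd]
        convert! measure_count_ge_le (measurableSet_strip k l r) he J
          (show 0 < s / 4 by positivity) (show (0 : ℝ) ≤ 1 / k by positivity)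
          (uniformSquare_strip_le hk0 l r)
    _ ≤ _ := by
        rw [Finset.sum_const, nsmul_eq_mul, ← ENNReal.ofReal_natCast,
          ← ENNReal.ofReal_mul (by positivity), Finset.card_range]
        refine ENNReal.ofReal_le_ofReal ?_
        rw [div_pow, hs2]
        -- The `k` strips of the union bound cancel the `1 / k` in the variance, which is why
        -- Chebyshev's inequality is enough.
        have : (k : ℝ) * (J * (1 / (k : ℝ)) / (n * Real.log n / 4 ^ 2)) =
            16 * J / (n * Real.log n) := by
          field_simp
          norm_num
        rw [this, div_le_div_iff₀ (by positivity) (by linarith)]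
        nlinarith

/-- W.h.p. the placement of the primary nodes is good. -/
lemma tendsto_measure_not_goodPlacement :
    Tendsto (fun n : ℝ => poissonNetwork n
      {ω | ¬ GoodPlacement (cellsPerSide (cellArea n)) (loadBound n) ω}) atTop (𝓝 0) := by
  have hlog : ∀ C : ℝ, Tendsto (fun n : ℝ => ENNReal.ofReal (C / Real.log n)) atTop (𝓝 0) := by
    intro C
    rw [← ENNReal.ofReal_zero]
    exact ENNReal.tendsto_ofReal (Real.tendsto_log_atTop.const_div_atTop C)
  have hlim := (((tendsto_poissonNetwork_gt (ρ := 5 / 4) (by norm_num)).add (hlog 2)).add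
    (hlog 16)).add (hlog 16)
  simp only [add_zero] at hlim
  refine tendsto_of_tendsto_of_tendsto_of_le_of_le' tendsto_const_nhds hlim
    (Filter.Eventually.of_forall fun _ => zero_le) ?_
  filter_upwards [eventually_largeDensity] with n hn
  set k := cellsPerSide (cellArea n) with hk
  have hrow := measure_exists_crowded_strip_le hn 1 (e := fun j => 2 * j)
    fun a b h => by simpa using h
  have hcol := measure_exists_crowded_strip_le hn 0 (e := fun j => 2 * j + 1)
    fun a b h => by simpa using h
  have hsub : {ω : Config | ¬ GoodPlacement k (loadBound n) ω} ⊆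
      (({ω | ¬ ∀ i, ω.2 i ∈ unitSquare} ∪ {ω | ¬ ∀ i j, i ≠ j → ω.2 i ≠ ω.2 j}) ∪
      ((({ω | 5 / 4 * n < (ω.1 : ℝ)} ∪ {ω | ∃ c c', InGrid k c ∧ SameOrAdjacent c c' ∧
      c' ≠ c ∧ ∀ i < ω.1, ¬ Toward k c c' (ω.2 i)}) ∪
      {ω | (ω.1 : ℝ) ≤ 5 / 4 * n ∧ ∃ r < k, loadBound n <
        ((Finset.range (numPairs ω)).filter fun j =>
          ⌊(k : ℝ) * ω.2 (2 * j) 1⌋ = r).card}) ∪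
      {ω | (ω.1 : ℝ) ≤ 5 / 4 * n ∧ ∃ r < k, loadBound n <
        ((Finset.range (numPairs ω)).filter fun j =>
          ⌊(k : ℝ) * ω.2 (2 * j + 1) 0⌋ = r).card})) := by
    intro ω hω
    by_contra hcon
    simp only [Set.mem_union, Set.mem_ofPred_eq, not_or, not_not] at hcon
    obtain ⟨⟨hsq, hinj⟩, ⟨⟨hN, hhalf⟩, hrow⟩, hcol⟩ := hcon
    refine hω ⟨fun i _ => hsq i, ?_, ?_, ?_, ?_⟩
    · intro i _ j _ h
      by_contra hij
      exact hinj i j hij h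
    · intro c c' h1 h2 h3
      by_contra h
      push Not at h
      exact hhalf ⟨c, c', h1, h2, h3, h⟩
    · intro r hr
      by_contra h
      exact hrow ⟨not_lt.1 hN, r, hr, not_le.1 h⟩
    · intro r hr
      by_contra h
      exact hcol ⟨not_lt.1 hN, r, hr, not_le.1 h⟩
  refine (measure_mono hsub).trans ?_
  refine (measure_union_le _ _).trans ?_
  rw [measure_union_null (ae_nodes_mem_unitSquare n) (ae_nodes_injective n), zero_add]
  refine (measure_union_le _ _).trans (add_le_add ?_ hcol)
  refine (measure_union_le _ _).trans (add_le_add ?_ hrow)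
  exact (measure_union_le _ _).trans (add_le_add le_rfl (measure_exists_empty_half_le hn))

/-- Events that hold w.h.p. for the primary network alone hold w.h.p. -/
lemma whp_of_tendsto {β : ℝ} {good : ℝ → Set (Config × Config)} {bad : ℝ → Set Config}
    (hbad : Tendsto (fun n => poissonNetwork n (bad n)) atTop (𝓝 0))
    (h : ∀ᶠ n in atTop, ∀ ω : Config × Config, ω.1 ∉ bad n → ω ∈ good n) : WHP β good := by
  refine tendsto_of_tendsto_of_tendsto_of_le_of_le' tendsto_const_nhds hbad
    (Filter.Eventually.of_forall fun _ => zero_le) ?_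
  filter_upwards [h] with n hn
  have hsub : (good n)ᶜ ⊆ bad n ×ˢ (Set.univ : Set Config) := by
    intro ω hω
    refine ⟨?_, trivial⟩
    by_contra hb
    exact hω (hn ω hb)
  refine (measure_mono hsub).trans ?_
  rw [Measure.prod_prod, measure_univ, mul_one]

/-! ## Throughputs -/

open Classical in
/-- The direct multihop operation of the primary network. -/
noncomputable def directMultihop (P α n : ℝ) (ω : Config) : Strategy :=
  if h : ∃ σ : Strategy, IsDirectMultihop P α (cellsPerSide (cellArea n)) ω σ ∧
      σ.rounds = 4 * loadBound n ∧ ∀ p ∈ σ.hops ω, σ.tx ω p ≠ σ.rx ω p then h.choose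
  -- An arbitrary value; for large `n` it is used only on placements that are not good.
  else ⟨fun _ => 0, fun _ _ => 0, 1, fun _ _ => 0⟩

lemma directMultihop_spec {P α n : ℝ} (hP : 0 < P) (hα : 0 < α) (hn : LargeDensity n) {ω : Config}
    (hω : GoodPlacement (cellsPerSide (cellArea n)) (loadBound n) ω) :
    IsDirectMultihop P α (cellsPerSide (cellArea n)) ω (directMultihop P α n ω) ∧
      (directMultihop P α n ω).rounds = 4 * loadBound n ∧
      ∀ p ∈ (directMultihop P α n ω).hops ω,
        (directMultihop P α n ω).tx ω p ≠ (directMultihop P α n ω).rx ω p := by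
  have hL : 0 < loadBound n := by
    unfold loadBound
    rw [Nat.floor_pos]
    have h1 : (1 : ℝ) ≤ √2 := Real.one_le_sqrt.2 (by norm_num)
    have h2 : (1 : ℝ) ≤ √(n * Real.log n) := Real.one_le_sqrt.2 (by
      nlinarith [hn.one_lt, hn.one_lt_log])
    nlinarith
  have h := hω.exists_strategy hP hα hn.two_le hL
  unfold directMultihop
  rw [dif_pos h]
  exact h.choose_spec

lemma Kp_pos {P N0 α : ℝ} (hP : 0 < P) (hN0 : 0 < N0) (hα : 2 < α) : 0 < Kp P N0 α := by
  have := interferenceConst_pos hP hα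
  have h : 0 < P / (N0 + interferenceConst P α) := by positivity
  unfold Kp capacity
  have := Real.logb_pos (b := 2) (by norm_num) (show 1 < 1 + P / (N0 + interferenceConst P α) by
    linarith)
  positivity

/-- Each hop is served once in `36 * loadBound n` slots. The 9 is the one in `Kp`, and `4 *
loadBound n ≤ 4 * √2 * √(n * log n)` explains the denominator of `Talone`. -/
lemma Talone_mul_le {P N0 α n : ℝ} (hP : 0 < P) (hN0 : 0 < N0) (hα : 2 < α)
    (hn : LargeDensity n) :
    Talone P N0 α n * (9 * (4 * loadBound n) : ℕ) ≤
      capacity (P / (N0 + interferenceConst P α)) := by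
  have hK := Kp_pos hP hN0 hα
  have h1 := hn.one_lt
  have h2 := hn.one_lt_log
  have hs : 0 < √(n * Real.log n) := by positivity
  have hL : (loadBound n : ℝ) ≤ √2 * √(n * Real.log n) := Nat.floor_le (by positivity)
  have hcap : capacity (P / (N0 + interferenceConst P α)) = 9 * Kp P N0 α := by unfold Kp; ring
  rw [hcap]
  unfold Talone
  push_cast
  calc Kp P N0 α / (4 * √2) * (1 / √(n * Real.log n)) * (9 * (4 * (loadBound n : ℝ)))
      ≤ Kp P N0 α / (4 * √2) * (1 / √(n * Real.log n)) *
          (9 * (4 * (√2 * √(n * Real.log n)))) := by gcongr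
    _ = 9 * Kp P N0 α := by field_simp

/-- Half of `ε` pays for the Poisson fluctuation, the other half, through `2 ≤ ε * n`, for a
possible unpaired node. -/
lemma Salone_le_sumThroughput {P N0 α n ε : ℝ} (hP : 0 < P) (hN0 : 0 < N0) (hα : 2 < α)
    (hn : LargeDensity n) (hεn : 2 ≤ ε * n) {ω : Config} (hω : (1 - ε / 2) * n ≤ ω.1) :
    Salone P N0 α ε n ≤ sumThroughput ω (Talone P N0 α n) := by
  have hK := Kp_pos hP hN0 hα
  have h1 := hn.one_lt
  have h2 := hn.one_lt_log
  have hn0 : 0 < n := by linarith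
  have hs : 0 < √(n * Real.log n) := by positivity
  have hsq : √(n / Real.log n) = n / √(n * Real.log n) := by
    rw [show n / Real.log n = n ^ 2 / (n * Real.log n) by field_simp,
      Real.sqrt_div' _ (by positivity), Real.sqrt_sq hn0.le]
  have hpairs : (1 - ε) * n / 2 ≤ numPairs ω := by
    have h3 : ω.1 ≤ 2 * numPairs ω + 1 := by unfold numPairs; omega
    have h4 : (ω.1 : ℝ) ≤ 2 * numPairs ω + 1 := by exact_mod_cast h3
    linarith
  unfold sumThroughput Salone Talone
  rw [hsq]
  calc Kp P N0 α * (1 - ε) / (8 * √2) * (n / √(n * Real.log n))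
      = Kp P N0 α / (4 * √2) * (1 / √(n * Real.log n)) * ((1 - ε) * n / 2) := by
        field_simp
        ring
    _ ≤ _ := by gcongr

lemma achievesAlone_directMultihop {P N0 α n : ℝ} (hP : 0 < P) (hN0 : 0 < N0) (hα : 2 < α)
    (hn : LargeDensity n) {ω : Config}
    (hω : GoodPlacement (cellsPerSide (cellArea n)) (loadBound n) ω) :
    AchievesAlone P N0 α ω (directMultihop P α n ω) (Talone P N0 α n) := by
  obtain ⟨hσ, hR, hne⟩ := directMultihop_spec (α := α) hP (by linarith) hn hω
  have hk : 0 < cellsPerSide (cellArea n) := by have := hn.two_le; omega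
  refine hσ.primaryRateAtLeast hP hN0 hα hk hne le_rfl (J := 0)
    (fun t i _ => by simp [secondaryInterference]) ?_
  rw [hR, add_zero]
  exact Talone_mul_le hP hN0 hα hn

lemma achievesInPresence_directMultihop {P N0 α n δloss δP : ℝ} (hP : 0 < P) (hN0 : 0 < N0)
    (hα : 2 < α) (hn : LargeDensity n) {ω : Config}
    (hω : GoodPlacement (cellsPerSide (cellArea n)) (loadBound n) ω)
    (hloss : δloss ∈ Set.Ioo (0 : ℝ) 1) (hδ : 0 ≤ δP) (hmax : δP ≤ deltaPMax P N0 α δloss)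
    (k' : ℕ) (ω' : Config) :
    AchievesInPresence P N0 α δP k' ω (directMultihop P α n ω) ω'
      ((1 - δloss) * Talone P N0 α n) := by
  obtain ⟨hσ, hR, hne⟩ := directMultihop_spec (α := α) hP (by linarith) hn hω
  have hk : 0 < cellsPerSide (cellArea n) := by have := hn.two_le; omega
  intro B hB
  refine hσ.primaryRateAtLeast hP hN0 hα hk hne hδ
    (fun t i hi => (hB t).secondaryInterference_le hP hδ hα hi) ?_
  rw [hR, mul_assoc]
  refine le_trans ?_ (one_sub_mul_capacity_le hP hN0 hα hloss hδ hmax)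
  exact mul_le_mul_of_nonneg_left (Talone_mul_le hP hN0 hα hn) (by linarith [hloss.2])

end CognitiveNetwork

/-! ### The main theorem -/

open CognitiveNetwork
theorem theorem1 (P N0 α : ℝ) (hP : 0 < P) (hN0 : 0 < N0) (hα : 2 < α) :
    ∃ protocol : ℝ → Config → Strategy,
      ∀ β : ℝ, 1 < β → ∀ ε ∈ Set.Ioo (0 : ℝ) 1,
        -- the stand-alone throughputs
        WHP β (fun n => {ω |
          IsDirectMultihop P α (cellsPerSide (cellArea n)) ω.1 (protocol n ω.1) ∧
          AchievesAlone P N0 α ω.1 (protocol n ω.1) (Talone P N0 α n) ∧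
          Salone P N0 α ε n ≤ sumThroughput ω.1 (Talone P N0 α n)}) ∧
        -- the throughputs in the presence of the secondary network
        ∀ δloss ∈ Set.Ioo (0 : ℝ) 1, ∀ δP ∈ Set.Ioo (0 : ℝ) (min (deltaPMax P N0 α δloss) 1),
          WHP β (fun n => {ω |
            IsDirectMultihop P α (cellsPerSide (cellArea n)) ω.1 (protocol n ω.1) ∧
            AchievesInPresence P N0 α δP (cellsPerSide (cellArea (n ^ β)))
              ω.1 (protocol n ω.1) ω.2 ((1 - δloss) * Talone P N0 α n) ∧
            (1 - δloss) * Salone P N0 α ε n ≤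
              sumThroughput ω.1 ((1 - δloss) * Talone P N0 α n)}) := by
  refine ⟨directMultihop P α, fun β _ ε hε => ?_⟩
  -- One exceptional event for both claims; it concerns the primary placement alone, so neither `β`
  -- nor the secondary network matters.
  have hbad : Tendsto (fun n : ℝ => poissonNetwork n
      ({ω | ¬ GoodPlacement (cellsPerSide (cellArea n)) (loadBound n) ω} ∪
        {ω | (ω.1 : ℝ) < (1 - ε / 2) * n})) atTop (𝓝 0) := by
    have h := tendsto_measure_not_goodPlacement.add
      (tendsto_poissonNetwork_lt (ρ := 1 - ε / 2) (by linarith [hε.2]) (by linarith [hε.1]))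
    rw [add_zero] at h
    exact tendsto_of_tendsto_of_tendsto_of_le_of_le tendsto_const_nhds h
      (fun _ => zero_le) fun _ => measure_union_le _ _
  have hlarge : ∀ᶠ n : ℝ in atTop, LargeDensity n ∧ 2 ≤ ε * n :=
    eventually_largeDensity.and
      ((tendsto_id.const_mul_atTop hε.1).eventually_ge_atTop 2)
  have hgood : ∀ (n : ℝ) (ω : Config × Config),
      ω.1 ∉ {ω | ¬ GoodPlacement (cellsPerSide (cellArea n)) (loadBound n) ω} ∪
        {ω : Config | (ω.1 : ℝ) < (1 - ε / 2) * n} →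
      GoodPlacement (cellsPerSide (cellArea n)) (loadBound n) ω.1 ∧
        (1 - ε / 2) * n ≤ (ω.1.1 : ℝ) := by
    intro n ω hω
    simpa only [Set.mem_union, Set.mem_ofPred_eq, not_or, not_not, not_lt] using hω
  constructor
  · refine whp_of_tendsto hbad ?_
    filter_upwards [hlarge] with n hn ω hω
    obtain ⟨h1, h2⟩ := hgood n ω hω
    exact ⟨(directMultihop_spec (α := α) hP (by linarith) hn.1 h1).1,
      achievesAlone_directMultihop hP hN0 hα hn.1 h1,
      Salone_le_sumThroughput hP hN0 hα hn.1 hn.2 h2⟩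
  · intro δloss hloss δP hδ
    refine whp_of_tendsto hbad ?_
    filter_upwards [hlarge] with n hn ω hω
    obtain ⟨h1, h2⟩ := hgood n ω hω
    refine ⟨(directMultihop_spec (α := α) hP (by linarith) hn.1 h1).1,
      achievesInPresence_directMultihop hP hN0 hα hn.1 h1 hloss hδ.1.le
        (hδ.2.le.trans (min_le_left _ _)) _ _, ?_⟩
    have h := Salone_le_sumThroughput hP hN0 hα hn.1 hn.2 h2
    unfold sumThroughput at h ⊢
    rw [mul_assoc]
    exact mul_le_mul_of_nonneg_left h (by linarith [hloss.2])
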